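/- Let $s_0,s_1,s_2,\ldots$ be real numbers. For $N\ge 1$ and $m\in\{0,1\}$ let $S^N_m$ be the real $N\times N$ Hankel matrix with entries $(S^N_m)_{ij}=s_{2N-i-j+m}$, $1\le i,j\le N$. For $a_1,a_2,\ldots>0$ and $b_1,b_2,\ldots\in\mathbb{R}$ let $A$ be the symmetric operator in $\ell^2(\mathbb{N};\mathbb{C})$, $\mathbb{N}=\{1,2,\ldots\}$, defined on finite sequences by $(A\theta)_1=b_1\theta_1+a_1\theta_2$ and $(A\theta)_n=a_n\theta_{n+1}+a_{n-1}\theta_{n-1}+b_n\theta_n$ for $n\ge 2$ (a Jacobi operator). A spectral measure corresponding to $A$ is a measure $\rho(B)=\langle E(B)e_1,e_1\rangle$ on the Borel sets of $\mathbb{R}$, where $E$ is the projection-valued spectral measure of some self-adjoint extension of $A$ in $\ell^2$ and $e_1=(1,0,0,\ldots)$. 1. There are $a_n>0$, $b_n\in\mathbb{R}$ and a spectral measure $\rho$ corresponding to the Jacobi operator $A$, with $\rho$ supported on $[0,1]$, such that $s_k=\int\lambda^k\,d\rho(\lambda)$ for all $k\ge 0$ (with absolutely convergent integrals) if and only if $s_0=1$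 and, for all $N\ge 1$, $S^N_0\ge S^N_1>0$ (that is, $S^N_0-S^N_1$ is positive semidefinite and $S^N_1$ is positive definite). 2. The Hausdorff moment problem is determinate: if $S^N_0\ge S^N_1>0$ for all $N\ge1$, or more generally if the Hausdorff moment problem for $(s_k)$ has a solution, then there is exactly one Borel measure $\rho$ on $\mathbb{R}$ supported on $[0,1]$ with $s_k=\int\lambda^k\,d\rho(\lambda)$ for all $k\ge0$. -/

import Mathlib

open MeasureTheory
open scoped ENNReal

noncomputable section

/-- The complex Hilbert space `ℓ²`. Coordinates are numbered from `0`, so that coordinate `n` here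
is the coordinate `n + 1` of sequences numbered from `1`; in particular `e₁` is `ellTwoFirst`. -/
abbrev EllTwo : Type := lp (fun _ : ℕ => ℂ) 2

/-- The first standard basis vector `e₁ = (1, 0, 0, …)` of `ℓ²`. -/
def ellTwoFirst : EllTwo := lp.single 2 (0 : ℕ) (1 : ℂ)

/-- The formal action on sequences of the Jacobi matrix with diagonal `b 0, b 1, …` and
off-diagonal `a 0, a 1, …` (the entries `b₁, b₂, …` and `a₁, a₂, …`). -/
def jacobiAction (a b : ℕ → ℝ) (θ : ℕ → ℂ) : ℕ → ℂ
  | 0 => b 0 * θ 0 + a 0 * θ 1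
  | n + 1 => a (n + 1) * θ (n + 2) + a n * θ n + b (n + 1) * θ (n + 1)

theorem jacobiAction_add (a b : ℕ → ℝ) (x y : ℕ → ℂ) :
    jacobiAction a b (x + y) = jacobiAction a b x + jacobiAction a b y := by
  funext n
  cases n <;> simp only [jacobiAction, Pi.add_apply] <;> ring

theorem jacobiAction_smul (a b : ℕ → ℝ) (c : ℂ) (x : ℕ → ℂ) :
    jacobiAction a b (c • x) = c • jacobiAction a b x := by
  funext n
  cases n <;> simp only [jacobiAction, Pi.smul_apply, smul_eq_mul] <;> ring

/-- The finite sequences, as a subspace of `ℓ²`. -/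
def finiteSequences : Submodule ℂ EllTwo where
  carrier := {θ | ∃ N : ℕ, ∀ n, N ≤ n → θ n = 0}
  zero_mem' := ⟨0, fun _ _ => rfl⟩
  add_mem' := by
    rintro x y ⟨N, hN⟩ ⟨M, hM⟩
    refine ⟨max N M, fun n hn => ?_⟩
    simp [hN n (le_trans (le_max_left _ _) hn), hM n (le_trans (le_max_right _ _) hn)]
  smul_mem' := by
    rintro c x ⟨N, hN⟩
    exact ⟨N, fun n hn => by simp [hN n hn]⟩

theorem memℓp_jacobiAction (a b : ℕ → ℝ) (θ : finiteSequences) :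
    Memℓp (E := fun _ : ℕ => ℂ) (jacobiAction a b (fun n => (θ : EllTwo) n)) 2 := by
  obtain ⟨θ, N, hN⟩ := θ
  refine Memℓp.of_exponent_ge (memℓp_zero ?_) zero_le
  refine (Set.finite_Iio (N + 1)).subset fun n hn => ?_
  by_contra h
  apply hn
  simp only [Set.mem_Iio, not_lt] at h
  obtain ⟨m, rfl⟩ : ∃ m, n = m + 1 := ⟨n - 1, by omega⟩
  simp [jacobiAction, hN (m + 2) (by omega), hN (m + 1) (by omega), hN m (by omega)]

/-- The symmetric Jacobi operator in `ℓ²`, defined on the finite sequences. -/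
def jacobiOperator (a b : ℕ → ℝ) : EllTwo →ₗ.[ℂ] EllTwo where
  domain := finiteSequences
  toFun :=
    { toFun := fun θ => ⟨jacobiAction a b (fun n => (θ : EllTwo) n), memℓp_jacobiAction a b θ⟩
      map_add' := by
        intro x y
        ext n
        exact congrFun (jacobiAction_add a b (fun n => (x : EllTwo) n) (fun n => (y : EllTwo) n)) n
      map_smul' := by
        intro c x
        ext n
        exact congrFun (jacobiAction_smul a b c (fun n => (x : EllTwo) n)) n }

/-- A projection-valued measure (resolution of the identity) on the Borel sets of `ℝ`. -/
structure ProjValuedMeasure (H : Type*) [NormedAddCommGroup H] [InnerProductSpace ℂ H]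
    [CompleteSpace H] where
  /-- The projection attached to a set; only the values at Borel sets matter. -/
  proj : Set ℝ → H →L[ℂ] H
  isStarProjection : ∀ B, MeasurableSet B → IsStarProjection (proj B)
  proj_univ : proj Set.univ = 1
  hasSum_proj : ∀ f : ℕ → Set ℝ, (∀ i, MeasurableSet (f i)) → Pairwise (Function.onFun Disjoint f) →
    ∀ x : H, HasSum (fun i => proj (f i) x) (proj (⋃ i, f i) x)

namespace ProjValuedMeasure

variable {H : Type*} [NormedAddCommGroup H] [InnerProductSpace ℂ H] [CompleteSpace H]

theorem proj_empty (E : ProjValuedMeasure H) : E.proj ∅ = 0 := by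
  ext x
  have h := E.hasSum_proj (fun _ => ∅) (fun _ => MeasurableSet.empty)
    (fun _ _ _ => disjoint_bot_left) x
  simpa using ((summable_const_iff _).1 h.summable)

theorem re_inner_proj_nonneg (E : ProjValuedMeasure H) (x : H) {B : Set ℝ}
    (hB : MeasurableSet B) : 0 ≤ (inner ℂ x (E.proj B x)).re :=
  (ContinuousLinearMap.IsPositive.of_isStarProjection
    (E.isStarProjection B hB)).re_inner_nonneg_right x

/-- The scalar measure `B ↦ ⟨E(B) x, x⟩` on `ℝ`. -/
def scalarMeasure (E : ProjValuedMeasure H) (x : H) : Measure ℝ :=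
  Measure.ofMeasurable (fun B _ => ENNReal.ofReal (inner ℂ x (E.proj B x)).re)
    (by simp [E.proj_empty])
    (by
      intro f hf hd
      have h := (Complex.hasSum_re ((E.hasSum_proj f hf hd x).mapL (innerSL ℂ x)))
      simp only [innerSL_apply_apply] at h
      rw [← h.tsum_eq]
      exact ENNReal.ofReal_tsum_of_nonneg (fun i => E.re_inner_proj_nonneg x (hf i)) h.summable)

/-- `E` is the spectral measure of the operator `T`, that is `T = ∫ λ dE(λ)`: the domain of `T`
consists of the `x` with `∫ λ² d⟨E x, x⟩ < ∞`, and `⟨T x, x⟩ = ∫ λ d⟨E x, x⟩` on it. -/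
def IsSpectralMeasureOf (E : ProjValuedMeasure H) (T : H →ₗ.[ℂ] H) : Prop :=
  (∀ x : H, x ∈ T.domain ↔ ∫⁻ t, ENNReal.ofReal (t ^ 2) ∂(E.scalarMeasure x) < ⊤) ∧
  ∀ x : T.domain, inner ℂ (x : H) (T x) = ((∫ t, t ∂(E.scalarMeasure (x : H)) : ℝ) : ℂ)

end ProjValuedMeasure

/-- `ρ` is a spectral measure corresponding to the Jacobi operator with entries `a`, `b`: it is
`⟨dE e₁, e₁⟩` for the projection-valued spectral measure `E` of a self-adjoint extension of the
operator. -/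
def IsJacobiSpectralMeasure (a b : ℕ → ℝ) (ρ : Measure ℝ) : Prop :=
  ∃ T : EllTwo →ₗ.[ℂ] EllTwo, jacobiOperator a b ≤ T ∧ IsSelfAdjoint T ∧
    ∃ E : ProjValuedMeasure EllTwo, E.IsSpectralMeasureOf T ∧ ρ = E.scalarMeasure ellTwoFirst

/-- `ρ` has moments `s 0, s 1, …`, that is, it solves the Hamburger moment problem for `s`. -/
def HasMoments (ρ : Measure ℝ) (s : ℕ → ℝ) : Prop :=
  ∀ k : ℕ, Integrable (fun t : ℝ => t ^ k) ρ ∧ ∫ t, t ^ k ∂ρ = s k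

/-- `ρ` solves the Hausdorff moment problem for `s`. -/
def SolvesHausdorff (ρ : Measure ℝ) (s : ℕ → ℝ) : Prop :=
  HasMoments ρ s ∧ ρ (Set.Icc 0 1)ᶜ = 0

/-- The Hausdorff moment problem for `s` is determinate: a solution exists and is unique. -/
def HausdorffDeterminate (s : ℕ → ℝ) : Prop :=
  ∃! ρ : Measure ℝ, SolvesHausdorff ρ s

/-- The Hankel matrix `S^N_m`, with entry `s_{2N-2+m-i-j}` in row `i` and column `j`,
rows and columns numbered from `0` (so `i + j ≤ 2N - 2` and no subtraction is truncated). -/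
def hankelS (s : ℕ → ℝ) (N m : ℕ) : Matrix (Fin N) (Fin N) ℝ :=
  Matrix.of fun i j => s (2 * N - 2 + m - ((i : ℕ) + (j : ℕ)))

/-- The condition `S^N_0 ≥ S^N_1 > 0` for all `N ≥ 1`. -/
def HausdorffCondition (s : ℕ → ℝ) : Prop :=
  ∀ N : ℕ, 1 ≤ N →
    (hankelS s N 0 - hankelS s N 1).PosSemidef ∧ (hankelS s N 1).PosDef

end

/-! The moments define a linear functional `L` on real polynomials. The Hankel conditions say that
`L ((1 - X) * r ^ 2) ≥ 0` for all `r` and `L (X * r ^ 2) > 0` for all `r ≠ 0`. By splitting off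
factors one at a time, such an `L` is nonnegative on every polynomial that is nonnegative on `[0,
1]` (`IsHausdorffPositive.nonneg_of_eval_nonneg`). The M. Riesz extension theorem and the
Riesz–Markov–Kakutani theorem then represent it by a measure on `[0, 1]`, which is unique by
Weierstrass approximation (`SolvesHausdorff.unique`).

For a measure on `[0, 1]`, the strict inequality means exactly that no finite set carries it. A
Jacobi spectral measure has this property: otherwise `e₁` would lie in a finite-dimensional span of
eigenvectors, from which the operator generates every `eₙ` because `aₙ ≠ 0`
(`IsJacobiSpectralMeasure.measure_compl_ne_zero`). Conversely, if `ρ` is a probability measure on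
`[0, 1]` not carried by a finite set, multiplication by `t` on `L²(ρ)` is bounded and self-adjoint
with cyclic vector `1`. Gram–Schmidt on `1, t, t², …` turns it into a Jacobi matrix, and `1` into
`e₁` (`exists_jacobi_of_cyclic`, `exists_isJacobiSpectralMeasure`). -/

open Polynomial in
/-- The linear functional on polynomials with `X ^ n ↦ s n`. -/
def momentFunctional (s : ℕ → ℝ) : ℝ[X] →ₗ[ℝ] ℝ :=
  Polynomial.lsum fun n => LinearMap.mulRight ℝ (s n)

open Polynomial in
/-- A functional on polynomials that is nonnegative on `X r²` and on `(1 - X) r²` for all `r`. -/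
def IsHausdorffPositive (L : ℝ[X] →ₗ[ℝ] ℝ) : Prop :=
  ∀ r : ℝ[X], 0 ≤ L (X * r ^ 2) ∧ 0 ≤ L ((1 - X) * r ^ 2)

/-! ### Hankel matrices as quadratic forms of the moment functional. -/

section MomentFunctional

open Polynomial

theorem momentFunctional_monomial (s : ℕ → ℝ) (n : ℕ) (c : ℝ) :
    momentFunctional s (monomial n c) = c * s n := by
  simp [momentFunctional, Polynomial.lsum_apply, Polynomial.sum_monomial_index]

theorem momentFunctional_X_pow (s : ℕ → ℝ) (n : ℕ) : momentFunctional s (X ^ n) = s n := by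
  rw [X_pow_eq_monomial, momentFunctional_monomial, one_mul]

/-- The Hankel indices decrease along rows and columns, so coordinate `i` is the coefficient of `X ^
(N - 1 - i)`. The shift `m` becomes the weight `X ^ m`. -/
theorem dotProduct_hankelS_mulVec (s : ℕ → ℝ) (N m : ℕ) (x : Fin N → ℝ) :
    dotProduct x ((hankelS s N m).mulVec x) =
      momentFunctional s (X ^ m * (∑ i : Fin N, C (x i) * X ^ (N - 1 - (i : ℕ))) ^ 2) := by
  rw [pow_two, Finset.sum_mul_sum, Finset.mul_sum, map_sum]
  simp only [dotProduct, Matrix.mulVec, Finset.mul_sum, map_sum]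
  refine Finset.sum_congr rfl fun i _ => Finset.sum_congr rfl fun j _ => ?_
  have h : (X : ℝ[X]) ^ m * (C (x i) * X ^ (N - 1 - (i : ℕ)) * (C (x j) * X ^ (N - 1 - (j : ℕ)))) =
      monomial (2 * N - 2 + m - ((i : ℕ) + (j : ℕ))) (x i * x j) := by
    rw [← C_mul_X_pow_eq_monomial, C_mul]
    have : 2 * N - 2 + m - ((i : ℕ) + (j : ℕ)) = m + (N - 1 - (i : ℕ)) + (N - 1 - (j : ℕ)) := by
      have := i.2
      have := j.2
      omega
    rw [this, pow_add, pow_add]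
    ring
  rw [h, momentFunctional_monomial, hankelS, Matrix.of_apply]
  ring

theorem exists_eq_sum_reflect (r : ℝ[X]) : ∃ (N : ℕ) (x : Fin N → ℝ), 1 ≤ N ∧
    r = ∑ i : Fin N, C (x i) * X ^ (N - 1 - (i : ℕ)) := by
  refine ⟨r.natDegree + 1, fun i => r.coeff (r.natDegree + 1 - 1 - i), by omega, ?_⟩
  conv_lhs => rw [r.as_sum_range_C_mul_X_pow]
  rw [← Finset.sum_range_reflect, Finset.sum_range]

theorem sum_reflect_ne_zero {N : ℕ} {x : Fin N → ℝ} (hx : x ≠ 0) :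
    (∑ i : Fin N, C (x i) * X ^ (N - 1 - (i : ℕ)) : ℝ[X]) ≠ 0 := by
  intro h
  apply hx
  funext j
  have h2 := congrArg (fun p : ℝ[X] => p.coeff (N - 1 - (j : ℕ))) h
  simp only [finsetSum_coeff, coeff_C_mul, coeff_X_pow, coeff_zero] at h2
  rw [Finset.sum_eq_single j] at h2
  · simpa using h2
  · intro i _ hij
    have : N - 1 - (j : ℕ) ≠ N - 1 - (i : ℕ) := by
      have := i.2
      have := j.2
      have : (i : ℕ) ≠ j := fun h => hij (Fin.ext h)
      omega
    simp [this]
  · simp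

theorem hankelS_isHermitian (s : ℕ → ℝ) (N m : ℕ) : (hankelS s N m).IsHermitian := by
  ext i j
  simp [hankelS, add_comm]

theorem hausdorffCondition_iff (s : ℕ → ℝ) :
    HausdorffCondition s ↔ (∀ r : ℝ[X], 0 ≤ momentFunctional s ((1 - X) * r ^ 2)) ∧
      ∀ r : ℝ[X], r ≠ 0 → 0 < momentFunctional s (X * r ^ 2) := by
  have key : ∀ (N : ℕ) (x : Fin N → ℝ),
      dotProduct x ((hankelS s N 0 - hankelS s N 1).mulVec x) =
      momentFunctional s ((1 - X) * (∑ i : Fin N, C (x i) * X ^ (N - 1 - (i : ℕ))) ^ 2) := by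
    intro N x
    rw [Matrix.sub_mulVec, dotProduct_sub, dotProduct_hankelS_mulVec, dotProduct_hankelS_mulVec,
      ← map_sub]
    congr 1
    ring
  constructor
  · refine fun h => ⟨fun r => ?_, fun r hr => ?_⟩
    · obtain ⟨N, x, hN, rfl⟩ := exists_eq_sum_reflect r
      rw [← key]
      simpa using (h N hN).1.dotProduct_mulVec_nonneg x
    · obtain ⟨N, x, hN, rfl⟩ := exists_eq_sum_reflect r
      have hx : x ≠ 0 := by
        rintro rfl
        simp at hr
      have := (h N hN).2.dotProduct_mulVec_pos hx
      rw [star_trivial, dotProduct_hankelS_mulVec, pow_one] at this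
      exact this
  · rintro ⟨h0, h1⟩ N hN
    refine ⟨Matrix.PosSemidef.of_dotProduct_mulVec_nonneg
      ((hankelS_isHermitian s N 0).sub (hankelS_isHermitian s N 1)) fun x => ?_,
      Matrix.PosDef.of_dotProduct_mulVec_pos (hankelS_isHermitian s N 1) fun x hx => ?_⟩
    · rw [star_trivial, key]
      exact h0 _
    · rw [star_trivial, dotProduct_hankelS_mulVec, pow_one]
      exact h1 _ (sum_reflect_ne_zero hx)

/-! ### Polynomials nonnegative on the unit interval. -/

namespace IsHausdorffPositive

variable {L : ℝ[X] →ₗ[ℝ] ℝ}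

theorem of_hausdorffCondition {s : ℕ → ℝ} (h : HausdorffCondition s) :
    IsHausdorffPositive (momentFunctional s) := fun r => by
  obtain ⟨h0, h1⟩ := (hausdorffCondition_iff s).1 h
  refine ⟨?_, h0 r⟩
  by_cases hr : r = 0
  · simp [hr]
  · exact (h1 r hr).le

theorem nonneg_sq (hL : IsHausdorffPositive L) (r : ℝ[X]) : 0 ≤ L (r ^ 2) := by
  have : r ^ 2 = X * r ^ 2 + (1 - X) * r ^ 2 := by ring
  rw [this, map_add]
  exact add_nonneg (hL r).1 (hL r).2

theorem add {M : ℝ[X] →ₗ[ℝ] ℝ} (hL : IsHausdorffPositive L) (hM : IsHausdorffPositive M) :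
    IsHausdorffPositive (L + M) := fun r =>
  ⟨add_nonneg (hL r).1 (hM r).1, add_nonneg (hL r).2 (hM r).2⟩

theorem smul {c : ℝ} (hc : 0 ≤ c) (hL : IsHausdorffPositive L) :
    IsHausdorffPositive (c • L) := fun r =>
  ⟨mul_nonneg hc (hL r).1, mul_nonneg hc (hL r).2⟩

/-- This and the next closure properties allow a factor that is nonnegative on `[0, 1]` to be moved
from a polynomial into the functional. -/
theorem mulLeft_sq (hL : IsHausdorffPositive L) (q : ℝ[X]) :
    IsHausdorffPositive (L ∘ₗ LinearMap.mulLeft ℝ (q ^ 2)) := fun r => by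
  have h1 : q ^ 2 * (X * r ^ 2) = X * (q * r) ^ 2 := by ring
  have h2 : q ^ 2 * ((1 - X) * r ^ 2) = (1 - X) * (q * r) ^ 2 := by ring
  simp only [LinearMap.comp_apply, LinearMap.mulLeft_apply, h1, h2]
  exact hL _

theorem nonneg_X_mul_one_sub (hL : IsHausdorffPositive L) (r : ℝ[X]) :
    0 ≤ L (X * (1 - X) * r ^ 2) := by
  have : X * (1 - X) * r ^ 2 = X * ((1 - X) * r) ^ 2 + (1 - X) * (X * r) ^ 2 := by ring
  rw [this, map_add]
  exact add_nonneg (hL _).1 (hL _).2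

theorem mulLeft_X (hL : IsHausdorffPositive L) :
    IsHausdorffPositive (L ∘ₗ LinearMap.mulLeft ℝ X) := fun r => by
  have h1 : X * (X * r ^ 2) = (X * r) ^ 2 := by ring
  have h2 : X * ((1 - X) * r ^ 2) = X * (1 - X) * r ^ 2 := by ring
  simp only [LinearMap.comp_apply, LinearMap.mulLeft_apply, h1, h2]
  exact ⟨hL.nonneg_sq _, hL.nonneg_X_mul_one_sub r⟩

theorem mulLeft_one_sub_X (hL : IsHausdorffPositive L) :
    IsHausdorffPositive (L ∘ₗ LinearMap.mulLeft ℝ (1 - X)) := fun r => by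
  have h1 : (1 - X) * (X * r ^ 2) = X * (1 - X) * r ^ 2 := by ring
  have h2 : (1 - X) * ((1 - X) * r ^ 2) = ((1 - X) * r) ^ 2 := by ring
  simp only [LinearMap.comp_apply, LinearMap.mulLeft_apply, h1, h2]
  exact ⟨hL.nonneg_X_mul_one_sub r, hL.nonneg_sq _⟩

/-- Dividing `p` by `X - a` leaves the sign of the quotient unknown at `a` only; continuity fills
the gap. -/
theorem eval_nonneg_of_forall_notMem {p : ℝ[X]} {F : Set ℝ} (hF : F.Finite)
    (h : ∀ x ∈ Set.Icc (0 : ℝ) 1, x ∉ F → 0 ≤ p.eval x) : ∀ x ∈ Set.Icc (0 : ℝ) 1, 0 ≤ p.eval x := by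
  have hd : Dense (Fᶜ) := hF.countable.dense_compl ℝ
  have h2 : Set.Ioo (0 : ℝ) 1 ⊆ closure (Set.Ioo (0 : ℝ) 1 ∩ Fᶜ) :=
    hd.open_subset_closure_inter isOpen_Ioo
  have h3 : Set.Icc (0 : ℝ) 1 ⊆ closure (Set.Ioo (0 : ℝ) 1 ∩ Fᶜ) := by
    rw [← closure_Ioo (zero_ne_one (α := ℝ))]
    exact closure_minimal h2 isClosed_closure
  have h4 : IsClosed {x : ℝ | 0 ≤ p.eval x} := isClosed_le continuous_const p.continuous
  have h5 : closure (Set.Ioo (0 : ℝ) 1 ∩ Fᶜ) ⊆ {x : ℝ | 0 ≤ p.eval x} :=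
    closure_minimal (fun x hx => h x ⟨hx.1.1.le, hx.1.2.le⟩ hx.2) h4
  exact fun x hx => h5 (h3 hx)

/-- A nonreal root `z` comes with its conjugate, and `(X - z) (X - z̄) = (X - re z)² + (im z)²`. -/
theorem exists_quadratic_dvd {p : ℝ[X]} (hp : 0 < p.natDegree) (h : ∀ x : ℝ, ¬ p.IsRoot x) :
    ∃ a b : ℝ, ((X - C a) ^ 2 + C b ^ 2) ∣ p := by
  obtain ⟨z, hz⟩ := Complex.exists_root (f := p.map (algebraMap ℝ ℂ))
    (by rw [degree_map]; exact natDegree_pos_iff_degree_pos.1 hp)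
  have hz' : aeval z p = 0 := by
    rw [IsRoot, eval_map_algebraMap] at hz
    exact hz
  have him : z.im ≠ 0 := by
    intro hi
    apply h z.re
    have : z = ((z.re : ℝ) : ℂ) := by apply Complex.ext <;> simp [hi]
    rw [this] at hz'
    have h2 := aeval_algebraMap_apply ℂ z.re p
    simp only [Complex.coe_algebraMap, hz', coe_aeval_eq_eval] at h2
    exact_mod_cast h2.symm
  refine ⟨z.re, z.im, ?_⟩
  have := Polynomial.quadratic_dvd_of_aeval_eq_zero_im_ne_zero p hz' him
  convert this using 1
  have h3 : ‖z‖ ^ 2 = z.re ^ 2 + z.im ^ 2 := by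
    rw [Complex.sq_norm, Complex.normSq_apply]
    ring
  rw [h3]
  simp only [map_add, map_mul, map_pow, map_ofNat]
  ring

/-- A functional that is nonnegative on `X r²` and `(1 - X) r²` is nonnegative on all polynomials
that are nonnegative on `[0, 1]`. -/
theorem nonneg_of_eval_nonneg {p : ℝ[X]} (hL : IsHausdorffPositive L)
    (hp : ∀ x ∈ Set.Icc (0 : ℝ) 1, 0 ≤ p.eval x) : 0 ≤ L p := by
  -- The induction must generalize `L`: each step lowers the degree of `p` by absorbing one factor
  -- into the functional.
  induction hn : p.natDegree using Nat.strong_induction_on generalizing p L with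
  | _ n ih =>
  subst hn
  by_cases hp0 : p.natDegree = 0
  · obtain ⟨c, rfl⟩ := natDegree_eq_zero.1 hp0
    have hc : 0 ≤ c := by simpa using hp 0 (by simp)
    have h1 := hL.nonneg_sq 1
    rw [← mul_one (C c), ← smul_eq_C_mul, map_smul]
    exact mul_nonneg hc (by simpa using h1)
  have hpne : p ≠ 0 := by
    rintro rfl
    simp at hp0
  by_cases hroot : ∃ a, p.IsRoot a
  swap
  · obtain ⟨a, b, q, hq⟩ := exists_quadratic_dvd (Nat.pos_of_ne_zero hp0) (not_exists.1 hroot)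
    have hd : ((X - C a) ^ 2 + C b ^ 2 : ℝ[X]).natDegree = 2 := by
      rw [← C_pow, natDegree_add_C, natDegree_pow, natDegree_X_sub_C]
    have hq0 : q ≠ 0 := by
      rintro rfl
      simp [hq] at hpne
    have hf0 : ((X - C a) ^ 2 + C b ^ 2 : ℝ[X]) ≠ 0 := by
      intro h
      simp [h] at hd
    have hdeg : q.natDegree < p.natDegree := by
      rw [hq, natDegree_mul hf0 hq0, hd]
      omega
    have hM := (hL.mulLeft_sq (X - C a)).add (hL.mulLeft_sq (C b))
    have := ih _ hdeg hM (p := q) (fun x hx => ?_) rfl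
    · simpa [hq, add_mul] using this
    · have h1 := hp x hx
      have h2 : p.eval x ≠ 0 := fun h => hroot ⟨x, h⟩
      rw [hq] at h1 h2
      simp only [eval_mul, eval_add, eval_pow, eval_sub, eval_X, eval_C] at h1 h2
      have h3 : 0 ≤ (x - a) ^ 2 + b ^ 2 := by positivity
      have h4 : 0 < (x - a) ^ 2 + b ^ 2 := lt_of_le_of_ne h3 fun h => h2 (by rw [← h, zero_mul])
      exact nonneg_of_mul_nonneg_right h1 h4
  obtain ⟨a, ha⟩ := hroot
  obtain ⟨q, hq⟩ := dvd_iff_isRoot.2 ha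
  have hq0 : q ≠ 0 := by
    rintro rfl
    simp [hq] at hpne
  have hdeg : p.natDegree = 1 + q.natDegree := by
    rw [hq, natDegree_mul (X_sub_C_ne_zero a) hq0, natDegree_X_sub_C]
  have hpe : ∀ x, p.eval x = (x - a) * q.eval x := fun x => by simp [hq]
  rcases le_or_gt a 0 with ha0 | ha0
  -- A root `a ≤ 0`: the factor is `X - a = X + (-a)`, a nonnegative combination of `X` and `1`.
  · have hM := hL.mulLeft_X.add (hL.smul (neg_nonneg.2 ha0))
    have := ih _ (by omega) hM (p := q) (eval_nonneg_of_forall_notMem (Set.finite_singleton a) ?_) rfl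
    · rw [hq, sub_mul, ← smul_eq_C_mul, map_sub, map_smul]
      simpa [sub_eq_add_neg] using this
    · intro x hx hxa
      have h1 := hp x hx
      rw [hpe] at h1
      have h2 : x ≠ a := hxa
      exact nonneg_of_mul_nonneg_right h1 (sub_pos.2 (lt_of_le_of_ne (ha0.trans hx.1) h2.symm))
  rcases le_or_gt 1 a with ha1 | ha1
  -- A root `a ≥ 1`: here `p = (a - X) * (-q)` with `a - X = (1 - X) + (a - 1)`.
  · have hM := hL.mulLeft_one_sub_X.add (hL.smul (sub_nonneg.2 ha1))
    have := ih _ (by simp; omega) hM (p := -q) (eval_nonneg_of_forall_notMem (Set.finite_singleton a) ?_) rfl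
    · rw [hq, sub_mul, ← smul_eq_C_mul, map_sub, map_smul]
      simp [sub_mul] at this ⊢
      linarith
    · intro x hx hxa
      have h1 := hp x hx
      rw [hpe] at h1
      have h2 : x ≠ a := hxa
      rw [eval_neg]
      exact nonneg_of_mul_nonneg_right (by linarith : 0 ≤ (a - x) * (-q.eval x))
        (sub_pos.2 (lt_of_le_of_ne (hx.2.trans ha1) h2))
  -- An interior root: `q` is nonpositive to the left of `a` and nonnegative to the right, so `q`
  -- vanishes at `a` and the square `(X - a)²` divides `p`.
  have hright : ∀ x ∈ Set.Ioc a 1, 0 ≤ q.eval x := fun x hx => by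
    have h1 := hp x ⟨ha0.le.trans hx.1.le, hx.2⟩
    rw [hpe] at h1
    exact nonneg_of_mul_nonneg_right h1 (sub_pos.2 hx.1)
  have hleft : ∀ x ∈ Set.Ico 0 a, q.eval x ≤ 0 := fun x hx => by
    have h1 := hp x ⟨hx.1, hx.2.le.trans ha1.le⟩
    rw [hpe] at h1
    have h2 : x - a < 0 := sub_neg.2 hx.2
    nlinarith
  have hqa : q.IsRoot a := by
    refine le_antisymm ?_ ?_
    · have hc : IsClosed {x : ℝ | q.eval x ≤ 0} := isClosed_le q.continuous continuous_const
      have : closure (Set.Ico 0 a) ⊆ {x : ℝ | q.eval x ≤ 0} := closure_minimal hleft hc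
      rw [closure_Ico ha0.ne] at this
      exact this ⟨ha0.le, le_rfl⟩
    · have hc : IsClosed {x : ℝ | 0 ≤ q.eval x} := isClosed_le continuous_const q.continuous
      have : closure (Set.Ioc a 1) ⊆ {x : ℝ | 0 ≤ q.eval x} := closure_minimal hright hc
      rw [closure_Ioc ha1.ne] at this
      exact this ⟨le_rfl, ha1.le⟩
  obtain ⟨r, hr⟩ := dvd_iff_isRoot.2 hqa
  have hr0 : r ≠ 0 := by
    rintro rfl
    simp [hr] at hq0
  have hdegr : q.natDegree = 1 + r.natDegree := by
    rw [hr, natDegree_mul (X_sub_C_ne_zero a) hr0, natDegree_X_sub_C]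
  have := ih _ (by omega) (hL.mulLeft_sq (X - C a)) (p := r)
    (eval_nonneg_of_forall_notMem (Set.finite_singleton a) ?_) rfl
  · have h2 : p = (X - C a) ^ 2 * r := by rw [hq, hr]; ring
    rw [h2]
    exact this
  · intro x hx hxa
    have h1 := hp x hx
    rw [hpe, hr] at h1
    simp only [eval_mul, eval_sub, eval_X, eval_C] at h1
    have h2 : x ≠ a := hxa
    refine nonneg_of_mul_nonneg_right (by linarith : 0 ≤ (x - a) ^ 2 * r.eval x) ?_
    exact sq_pos_of_ne_zero (sub_ne_zero.2 h2)

end IsHausdorffPositive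

end MomentFunctional

/-! ### Existence and uniqueness of the measure on the unit interval. -/

section HausdorffMeasure

open Polynomial

theorem HasMoments.integrable_eval {ρ : Measure ℝ} {s : ℕ → ℝ} (h : HasMoments ρ s) (p : ℝ[X]) :
    Integrable (fun t => p.eval t) ρ := by
  induction p using Polynomial.induction_on' with
  | add p q hp hq =>
    simp only [eval_add]
    exact hp.add hq
  | monomial n a => simpa using (h n).1.const_mul a

theorem HasMoments.integral_eval {ρ : Measure ℝ} {s : ℕ → ℝ} (h : HasMoments ρ s) (p : ℝ[X]) :
    ∫ t, p.eval t ∂ρ = momentFunctional s p := by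
  induction p using Polynomial.induction_on' with
  | add p q hp hq =>
    simp only [eval_add]
    rw [integral_add (h.integrable_eval p) (h.integrable_eval q), hp, hq, map_add]
  | monomial n a =>
    simp only [eval_monomial]
    rw [integral_const_mul, (h n).2, momentFunctional_monomial]

theorem HasMoments.isFiniteMeasure {ρ : Measure ℝ} {s : ℕ → ℝ} (h : HasMoments ρ s) :
    IsFiniteMeasure ρ := by
  have := (h 0).1
  simp only [pow_zero] at this
  exact (integrable_const_iff.1 this).resolve_left one_ne_zero

/-- A measure on the line with all moments, whose support is an infinite subset of `[0, 1]`, has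
moments satisfying the Hausdorff condition, and conversely. -/
theorem SolvesHausdorff.hausdorffCondition_iff {ρ : Measure ℝ} {s : ℕ → ℝ}
    (h : SolvesHausdorff ρ s) :
    HausdorffCondition s ↔ ∀ F : Set ℝ, F.Finite → ρ Fᶜ ≠ 0 := by
  have hae : ∀ᵐ t ∂ρ, t ∈ Set.Icc (0 : ℝ) 1 := h.2
  rw [_root_.hausdorffCondition_iff]
  constructor
  · rintro ⟨-, hpos⟩ F hF h0
    -- If a finite set carried `ρ`, the polynomial vanishing on it would contradict strict
    -- positivity.
    set q : ℝ[X] := ∏ l ∈ hF.toFinset, (X - C l) with hq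
    have hq0 : q ≠ 0 := Finset.prod_ne_zero_iff.2 fun l _ => X_sub_C_ne_zero l
    have hz : ∀ᵐ t ∂ρ, (X * q ^ 2).eval t = 0 := by
      have : ∀ᵐ t ∂ρ, t ∈ F := h0
      filter_upwards [this] with t ht
      have : q.eval t = 0 := by
        rw [hq, eval_prod]
        exact Finset.prod_eq_zero (hF.mem_toFinset.2 ht) (by simp)
      simp [this]
    have := hpos q hq0
    rw [← h.1.integral_eval, integral_congr_ae hz] at this
    simp at this
  · intro hF
    refine ⟨fun r => ?_, fun r hr => ?_⟩
    · rw [← h.1.integral_eval]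
      refine integral_nonneg_of_ae ?_
      filter_upwards [hae] with t ht
      simp only [Pi.zero_apply, eval_mul, eval_sub, eval_one, eval_X, eval_pow]
      exact mul_nonneg (sub_nonneg.2 ht.2) (sq_nonneg _)
    · have hr' : X * r ^ 2 ≠ 0 := mul_ne_zero X_ne_zero (pow_ne_zero _ hr)
      have hnn : 0 ≤ᵐ[ρ] fun t => (X * r ^ 2).eval t := by
        filter_upwards [hae] with t ht
        simp only [Pi.zero_apply, eval_mul, eval_X, eval_pow]
        exact mul_nonneg ht.1 (sq_nonneg _)
      rw [← h.1.integral_eval]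
      refine lt_of_le_of_ne (integral_nonneg_of_ae hnn) fun h0 => ?_
      have hz := (integral_eq_zero_iff_of_nonneg_ae hnn (h.1.integrable_eval _)).1 h0.symm
      refine hF {t | (X * r ^ 2).IsRoot t} (finite_setOfPred_isRoot hr') ?_
      exact hz

/-- Moments fix the integrals of polynomials, and on `[0, 1]` every bounded continuous function is a
uniform limit of polynomials. -/
theorem SolvesHausdorff.unique {ρ μ : Measure ℝ} {s : ℕ → ℝ} (hρ : SolvesHausdorff ρ s)
    (hμ : SolvesHausdorff μ s) : ρ = μ := by
  have := hρ.1.isFiniteMeasure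
  have := hμ.1.isFiniteMeasure
  refine ext_of_forall_integral_eq_of_IsFiniteMeasure fun f => ?_
  have key : ∀ ε > 0, |∫ x, f x ∂ρ - ∫ x, f x ∂μ| ≤ ε * (ρ.real Set.univ + μ.real Set.univ) := by
    intro ε hε
    obtain ⟨p, hp⟩ := exists_polynomial_near_of_continuousOn 0 1 f f.continuous.continuousOn ε hε
    have aux : ∀ ν : Measure ℝ, IsFiniteMeasure ν → SolvesHausdorff ν s →
        |∫ x, f x ∂ν - momentFunctional s p| ≤ ε * ν.real Set.univ := by
      intro ν _ hν
      have hae : ∀ᵐ t ∂ν, t ∈ Set.Icc (0 : ℝ) 1 := hν.2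
      rw [← hν.1.integral_eval, ← integral_sub (f.integrable ν) (hν.1.integrable_eval p)]
      have hle : ∀ᵐ t ∂ν, ‖f t - p.eval t‖ ≤ ε := by
        filter_upwards [hae] with t ht
        rw [Real.norm_eq_abs, abs_sub_comm]
        exact (hp t ht).le
      exact norm_integral_le_of_norm_le_const hle
    have h1 := aux ρ inferInstance hρ
    have h2 := aux μ inferInstance hμ
    rw [abs_le] at h1 h2 ⊢
    constructor <;> linarith [h1.1, h1.2, h2.1, h2.2]
  by_contra hne
  have hpos : 0 < |∫ x, f x ∂ρ - ∫ x, f x ∂μ| := abs_pos.2 (sub_ne_zero.2 hne)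
  set C := ρ.real Set.univ + μ.real Set.univ with hC
  have hC0 : 0 ≤ C := add_nonneg measureReal_nonneg measureReal_nonneg
  -- Half of the discrepancy would dominate it; `C + 1` keeps the denominator positive even if both
  -- measures are zero.
  have h3 := key (|∫ x, f x ∂ρ - ∫ x, f x ∂μ| / (2 * (C + 1))) (by positivity)
  rw [div_mul_eq_mul_div, le_div_iff₀ (by positivity)] at h3
  nlinarith

open CompactlySupported in
theorem IsHausdorffPositive.exists_solvesHausdorff {s : ℕ → ℝ}
    (h : IsHausdorffPositive (momentFunctional s)) : ∃ ρ, SolvesHausdorff ρ s := by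
  set Φ : ℝ[X] →ₗ[ℝ] C(Set.Icc (0 : ℝ) 1, ℝ) :=
    (toContinuousMapOnAlgHom (Set.Icc (0 : ℝ) 1)).toLinearMap with hΦ
  have hΦa : ∀ p x, Φ p x = p.eval (x : ℝ) := fun p x => rfl
  -- Since `[0, 1]` is infinite, the functional is well defined on polynomial functions.
  have hinj : Function.Injective Φ := by
    intro p q hpq
    refine eq_of_infinite_eval_eq p q ((Set.Icc_infinite (zero_lt_one (α := ℝ))).mono fun x hx => ?_)
    exact congrArg (fun g : C(Set.Icc (0 : ℝ) 1, ℝ) => g ⟨x, hx⟩) hpq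
  let e := LinearEquiv.ofInjective Φ hinj
  let f : C(Set.Icc (0 : ℝ) 1, ℝ) →ₗ.[ℝ] ℝ :=
    ⟨LinearMap.range Φ, (momentFunctional s) ∘ₗ e.symm.toLinearMap⟩
  have hf : ∀ p, ∃ hp : Φ p ∈ f.domain, f ⟨Φ p, hp⟩ = momentFunctional s p := by
    intro p
    refine ⟨⟨p, rfl⟩, ?_⟩
    change momentFunctional s (e.symm ⟨Φ p, _⟩) = _
    congr 1
    exact e.symm_apply_apply p
  obtain ⟨g, hg, hgpos⟩ := riesz_extension (PointedCone.positive ℝ C(Set.Icc (0 : ℝ) 1, ℝ)) f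
    (by
      rintro ⟨_, p, rfl⟩ hp
      obtain ⟨hp', e1⟩ := hf p
      rw [e1]
      refine h.nonneg_of_eval_nonneg fun x hx => ?_
      exact ((PointedCone.mem_positive ℝ _).1 hp : (0 : C(Set.Icc (0 : ℝ) 1, ℝ)) ≤ Φ p) ⟨x, hx⟩)
    (by
      -- The domination hypothesis of the extension theorem: `‖y‖ + y ≥ 0`, and constants are
      -- polynomials.
      intro y
      refine ⟨⟨Φ (C ‖y‖), (hf _).1⟩, (PointedCone.mem_positive ℝ _).2 fun x => ?_⟩
      have h1 := neg_le_of_abs_le (y.norm_coe_le_norm x)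
      change 0 ≤ Φ (C ‖y‖) x + y x
      rw [hΦa, eval_C]
      linarith)
  let Λ : C_c(Set.Icc (0 : ℝ) 1, ℝ) →ₚ[ℝ] ℝ := PositiveLinearMap.mk₀
    { toFun := fun u => g u.toContinuousMap
      map_add' := fun u v => g.map_add u.toContinuousMap v.toContinuousMap
      map_smul' := fun c u => g.map_smul c u.toContinuousMap }
    (fun u hu => hgpos _ ((PointedCone.mem_positive ℝ _).2 hu))
  let ρ₀ := RealRMK.rieszMeasure Λ
  have hρ₀ : ∀ p : ℝ[X], ∫ x : Set.Icc (0 : ℝ) 1, p.eval (x : ℝ) ∂ρ₀ = momentFunctional s p := by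
    intro p
    have h1 := RealRMK.integral_rieszMeasure Λ
      (CompactlySupportedContinuousMap.continuousMapEquiv (Φ p))
    obtain ⟨hp', e1⟩ := hf p
    rw [← e1, ← hg]
    exact h1
  have hemb : MeasurableEmbedding ((↑) : Set.Icc (0 : ℝ) 1 → ℝ) :=
    MeasurableEmbedding.subtype_coe measurableSet_Icc
  refine ⟨ρ₀.map (↑), fun k => ⟨?_, ?_⟩, ?_⟩
  · rw [hemb.integrable_map_iff]
    exact Continuous.integrable_of_hasCompactSupport (by fun_prop)
      (HasCompactSupport.of_compactSpace _)
  · rw [hemb.integral_map, ← momentFunctional_X_pow s, ← hρ₀]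
    simp
  · rw [hemb.map_apply]
    simp

theorem HausdorffCondition.exists_solvesHausdorff {s : ℕ → ℝ} (h : HausdorffCondition s) :
    ∃ ρ, SolvesHausdorff ρ s :=
  (IsHausdorffPositive.of_hausdorffCondition h).exists_solvesHausdorff

theorem SolvesHausdorff.hausdorffDeterminate {ρ : Measure ℝ} {s : ℕ → ℝ}
    (h : SolvesHausdorff ρ s) : HausdorffDeterminate s :=
  ⟨ρ, h, fun _ hμ => hμ.unique h⟩

end HausdorffMeasure

/-! ### Projection-valued measures and eigenvectors at atoms. -/

section StarProjection

variable {H : Type*} [NormedAddCommGroup H] [InnerProductSpace ℂ H] [CompleteSpace H]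

theorem IsStarProjection.inner_apply_self {P : H →L[ℂ] H} (hP : IsStarProjection P) (x : H) :
    inner ℂ x (P x) = ((‖P x‖ ^ 2 : ℝ) : ℂ) := by
  have h1 : P (P x) = P x := congrArg (fun Q : H →L[ℂ] H => Q x) hP.isIdempotentElem.eq
  have h2 := hP.isSelfAdjoint.isSymmetric (P x) x
  simp only [ContinuousLinearMap.coe_coe, h1] at h2
  have h3 := hP.isSelfAdjoint.isSymmetric x (P x)
  simp only [ContinuousLinearMap.coe_coe, h1] at h3
  rw [← h3, inner_self_eq_norm_sq_to_K]
  norm_cast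

theorem IsStarProjection.norm_apply_le {P : H →L[ℂ] H} (hP : IsStarProjection P) (x : H) :
    ‖P x‖ ≤ ‖x‖ := by
  have h1 := norm_inner_le_norm (𝕜 := ℂ) x (P x)
  rw [hP.inner_apply_self, Complex.norm_real, Real.norm_of_nonneg (sq_nonneg _)] at h1
  by_contra! h
  nlinarith [norm_nonneg x]

end StarProjection

namespace ProjValuedMeasure

variable {H : Type*} [NormedAddCommGroup H] [InnerProductSpace ℂ H] [CompleteSpace H]
  (E : ProjValuedMeasure H)

theorem scalarMeasure_apply (x : H) {B : Set ℝ} (hB : MeasurableSet B) :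
    E.scalarMeasure x B = ENNReal.ofReal (inner ℂ x (E.proj B x)).re :=
  Measure.ofMeasurable_apply B hB

theorem scalarMeasure_apply' (x : H) {B : Set ℝ} (hB : MeasurableSet B) :
    E.scalarMeasure x B = ENNReal.ofReal (‖E.proj B x‖ ^ 2) := by
  rw [E.scalarMeasure_apply x hB, (E.isStarProjection B hB).inner_apply_self, Complex.ofReal_re]

theorem scalarMeasure_univ (x : H) : E.scalarMeasure x Set.univ = ENNReal.ofReal (‖x‖ ^ 2) := by
  rw [E.scalarMeasure_apply' x MeasurableSet.univ, E.proj_univ, one_apply_eq_self]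

instance isFiniteMeasure_scalarMeasure (x : H) : IsFiniteMeasure (E.scalarMeasure x) :=
  ⟨by rw [scalarMeasure_univ]; exact ENNReal.ofReal_lt_top⟩

theorem proj_apply_eq_zero_iff (x : H) {B : Set ℝ} (hB : MeasurableSet B) :
    E.proj B x = 0 ↔ E.scalarMeasure x B = 0 := by
  rw [E.scalarMeasure_apply' x hB, ENNReal.ofReal_eq_zero]
  refine ⟨fun h => by simp [h], fun h => ?_⟩
  have := le_antisymm h (sq_nonneg _)
  simpa using this

/-- Orthogonality follows from additivity alone: for `y = E(B) x`, `‖E(A) y‖² + ‖y‖² = ‖E(A ∪ B) y‖²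
≤ ‖y‖²`. -/
theorem proj_proj_of_disjoint {A B : Set ℝ} (hA : MeasurableSet A) (hB : MeasurableSet B)
    (h : Disjoint A B) (x : H) : E.proj A (E.proj B x) = 0 := by
  have h1 := measure_union (μ := E.scalarMeasure (E.proj B x)) h hB
  have h2 : E.proj B (E.proj B x) = E.proj B x :=
    congrArg (fun Q : H →L[ℂ] H => Q x) (E.isStarProjection B hB).isIdempotentElem.eq
  rw [E.scalarMeasure_apply' _ (hA.union hB), E.scalarMeasure_apply' _ hA,
    E.scalarMeasure_apply' _ hB, h2, ← ENNReal.ofReal_add (by positivity) (by positivity),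
    ENNReal.ofReal_eq_ofReal_iff (by positivity) (by positivity)] at h1
  have h3 := (E.isStarProjection _ (hA.union hB)).norm_apply_le (E.proj B x)
  have h4 : ‖E.proj A (E.proj B x)‖ ^ 2 ≤ 0 := by nlinarith [norm_nonneg (E.proj (A ∪ B) (E.proj B x))]
  have := le_antisymm h4 (sq_nonneg _)
  simpa using this

theorem proj_union {A B : Set ℝ} (hA : MeasurableSet A) (hB : MeasurableSet B)
    (h : Disjoint A B) (x : H) : E.proj (A ∪ B) x = E.proj A x + E.proj B x := by
  let f : ℕ → Set ℝ := fun n => match n with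
    | 0 => A
    | 1 => B
    | _ + 2 => ∅
  have h1 := E.hasSum_proj f
    (by
      rintro (_ | _ | n)
      exacts [hA, hB, MeasurableSet.empty])
    (by
      rintro (_ | _ | n) (_ | _ | m) hnm
      all_goals first
        | exact absurd rfl hnm
        | exact h
        | exact h.symm
        | exact disjoint_bot_left
        | exact disjoint_bot_right) x
  have h2 : ⋃ i, f i = A ∪ B := by
    ext t
    simp only [Set.mem_iUnion, Set.mem_union]
    constructor
    · rintro ⟨_ | _ | n, hn⟩
      exacts [Or.inl hn, Or.inr hn, hn.elim]
    · rintro (ht | ht)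
      exacts [⟨0, ht⟩, ⟨1, ht⟩]
  rw [h2] at h1
  have h3 : HasSum (fun i => E.proj (f i) x) (∑ i ∈ Finset.range 2, E.proj (f i) x) := by
    refine hasSum_sum_of_ne_finset_zero ?_
    rintro (_ | _ | n) hn
    · simp at hn
    · simp at hn
    · change E.proj ∅ x = 0
      rw [E.proj_empty, zero_apply]
  rw [h1.unique h3, Finset.sum_range_succ, Finset.sum_range_one]

theorem proj_finset (F : Finset ℝ) (x : H) :
    E.proj (F : Set ℝ) x = ∑ l ∈ F, E.proj {l} x := by
  induction F using Finset.induction_on with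
  | empty => simp [E.proj_empty]
  | insert l F hl ih =>
    rw [Finset.sum_insert hl, ← ih, Finset.coe_insert, Set.insert_eq,
      E.proj_union (measurableSet_singleton l) F.measurableSet (by simpa using hl)]

theorem eq_sum_proj_singleton {F : Finset ℝ} {x : H}
    (h : E.scalarMeasure x (F : Set ℝ)ᶜ = 0) : x = ∑ l ∈ F, E.proj {l} x := by
  have h1 := E.proj_union F.measurableSet F.measurableSet.compl disjoint_compl_right x
  rwa [Set.union_compl_self, E.proj_univ, (E.proj_apply_eq_zero_iff x F.measurableSet.compl).2 h,
    add_zero, proj_finset] at h1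

/-- The scalar measures of two vectors that differ by a vector in the range of `E {l}` agree
outside of `l`. -/
theorem scalarMeasure_restrict_add_proj (x y : H) (l : ℝ) :
    (E.scalarMeasure (E.proj {l} x + y)).restrict {l}ᶜ = (E.scalarMeasure y).restrict {l}ᶜ := by
  ext B hB
  have hm : MeasurableSet (B ∩ {l}ᶜ) := hB.inter (measurableSet_singleton l).compl
  rw [Measure.restrict_apply hB, Measure.restrict_apply hB, E.scalarMeasure_apply' _ hm,
    E.scalarMeasure_apply' _ hm, map_add, E.proj_proj_of_disjoint hm (measurableSet_singleton l)
      (disjoint_compl_left.mono_left Set.inter_subset_right), zero_add]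

variable {E} {T : H →ₗ.[ℂ] H}

namespace IsSpectralMeasureOf

theorem integrable (hE : E.IsSpectralMeasureOf T) (x : T.domain) :
    Integrable (fun t : ℝ => t) (E.scalarMeasure (x : H)) := by
  have h1 := (hE.1 x).1 x.2
  have h2 : MemLp (fun t : ℝ => t) 2 (E.scalarMeasure (x : H)) := by
    rw [memLp_two_iff_integrable_sq (by fun_prop)]
    refine ⟨by fun_prop, ?_⟩
    rw [hasFiniteIntegral_iff_ofReal (ae_of_all _ fun t => sq_nonneg t)]
    exact h1
  exact h2.integrable one_le_two

/-- The integrand `t - l` vanishes at `l`, so the quadratic form of `T - l` does not see the mass at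
`l`. -/
theorem inner_sub (hE : E.IsSpectralMeasureOf T) (x : T.domain) (l : ℝ) :
    inner ℂ (x : H) (T x) - l * inner ℂ (x : H) (x : H) =
      ((∫ t in ({l}ᶜ : Set ℝ), (t - l) ∂(E.scalarMeasure (x : H)) : ℝ) : ℂ) := by
  have h1 : ∫ t in ({l}ᶜ : Set ℝ), (t - l) ∂(E.scalarMeasure (x : H)) =
      ∫ t, (t - l) ∂(E.scalarMeasure (x : H)) := by
    refine setIntegral_eq_integral_of_forall_compl_eq_zero fun t ht => ?_
    have : t = l := by simpa using ht
    rw [this, sub_self]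
  rw [h1, integral_sub (hE.integrable x) (integrable_const l), hE.2, integral_const,
    measureReal_def, E.scalarMeasure_univ, ENNReal.toReal_ofReal (sq_nonneg _),
    inner_self_eq_norm_sq_to_K]
  push_cast
  rw [smul_eq_mul, mul_comm]
  push_cast
  rfl

theorem proj_singleton_mem (hE : E.IsSpectralMeasureOf T) (l : ℝ) (x : H) :
    E.proj {l} x ∈ T.domain := by
  rw [hE.1]
  have h1 : ∀ᵐ t ∂(E.scalarMeasure (E.proj {l} x)), t ∈ ({l} : Set ℝ) := by
    have hm := (measurableSet_singleton l).compl
    exact (E.proj_apply_eq_zero_iff _ hm).1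
      (E.proj_proj_of_disjoint hm (measurableSet_singleton l) disjoint_compl_left x)
  have h2 : (fun t : ℝ => ENNReal.ofReal (t ^ 2)) =ᵐ[E.scalarMeasure (E.proj {l} x)]
      fun _ => ENNReal.ofReal (l ^ 2) := by
    filter_upwards [h1] with t ht
    rw [Set.mem_singleton_iff.1 ht]
  rw [lintegral_congr_ae h2, lintegral_const]
  exact ENNReal.mul_lt_top ENNReal.ofReal_lt_top (measure_lt_top _ _)

/-- Vectors in the range of `E {l}` are eigenvectors with eigenvalue `l`. -/
theorem apply_proj_singleton (hE : E.IsSpectralMeasureOf T) (hT : Dense (T.domain : Set H))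
    (l : ℝ) (x : H) :
    T ⟨E.proj {l} x, hE.proj_singleton_mem l x⟩ = (l : ℂ) • E.proj {l} x := by
  set u : T.domain := ⟨E.proj {l} x, hE.proj_singleton_mem l x⟩ with hu
  -- `E` determines `T` only through quadratic forms. Adding `u` leaves the form of `T - l`
  -- unchanged, so its cross terms vanish, and taking `c = 1` and `c = I` below isolates `⟨y, (T -
  -- l) u⟩ = 0` on a dense domain.
  have hadd : ∀ y : T.domain, inner ℂ ((u + y : T.domain) : H) (T (u + y)) -
      l * inner ℂ ((u + y : T.domain) : H) ((u + y : T.domain) : H) =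
      inner ℂ (y : H) (T y) - l * inner ℂ (y : H) (y : H) := by
    intro y
    rw [hE.inner_sub, hE.inner_sub]
    congr 2
    exact E.scalarMeasure_restrict_add_proj x y l
  have hu0 : inner ℂ (u : H) (T u) - l * inner ℂ (u : H) (u : H) = 0 := by
    simpa using hadd 0
  have hcross : ∀ (c : ℂ) (y : T.domain), c * (inner ℂ (u : H) (T y) - l * inner ℂ (u : H) (y : H))
      + (starRingEnd ℂ) c * (inner ℂ (y : H) (T u) - l * inner ℂ (y : H) (u : H)) = 0 := by
    intro c y
    have := hadd (c • y)
    simp only [Submodule.coe_add, Submodule.coe_smul, LinearPMap.map_add, LinearPMap.map_smul,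
      inner_add_left, inner_add_right, inner_smul_left, inner_smul_right] at this
    linear_combination this - hu0
  have horth : ∀ y : T.domain, inner ℂ (y : H) (T u - (l : ℂ) • (u : H)) = 0 := by
    intro y
    have h1 := hcross 1 y
    have h2 := hcross Complex.I y
    rw [inner_sub_right, inner_smul_right]
    simp only [map_one, Complex.conj_I] at h1 h2
    linear_combination h1 / 2 + Complex.I / 2 * h2 - (inner ℂ (u : H) (T y) - l * inner ℂ (u : H) (y : H)
      - (inner ℂ (y : H) (T u) - l * inner ℂ (y : H) (u : H))) / 2 * Complex.I_sq
  have h0 : T u - (l : ℂ) • (u : H) = 0 :=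
    hT.eq_zero_of_inner_right (𝕜 := ℂ) fun v hv => horth ⟨v, hv⟩
  exact sub_eq_zero.1 h0

end IsSpectralMeasureOf

end ProjValuedMeasure

/-! ### Spectral measures of Jacobi operators have infinite support. -/

section Jacobi

theorem single_mem_finiteSequences (n : ℕ) : (lp.single 2 n (1 : ℂ) : EllTwo) ∈ finiteSequences :=
  ⟨n + 1, fun m hm => lp.single_apply_ne _ _ _ (by omega)⟩

theorem jacobiOperator_single_zero (a b : ℕ → ℝ) :
    jacobiOperator a b ⟨lp.single 2 0 (1 : ℂ), single_mem_finiteSequences 0⟩ =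
      (b 0 : ℂ) • (lp.single 2 0 (1 : ℂ) : EllTwo) + (a 0 : ℂ) • lp.single 2 1 (1 : ℂ) := by
  ext n
  change jacobiAction a b (fun n => (lp.single 2 0 (1 : ℂ) : EllTwo) n) n = _
  simp only [lp.coeFn_add, lp.coeFn_smul, Pi.add_apply, Pi.smul_apply, smul_eq_mul,
    lp.single_apply]
  rcases n with _ | _ | n <;> simp [jacobiAction]

theorem jacobiOperator_single_succ (a b : ℕ → ℝ) (k : ℕ) :
    jacobiOperator a b ⟨lp.single 2 (k + 1) (1 : ℂ), single_mem_finiteSequences (k + 1)⟩ =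
      (a k : ℂ) • (lp.single 2 k (1 : ℂ) : EllTwo) + (b (k + 1) : ℂ) • lp.single 2 (k + 1) (1 : ℂ)
        + (a (k + 1) : ℂ) • lp.single 2 (k + 2) (1 : ℂ) := by
  ext n
  change jacobiAction a b (fun n => (lp.single 2 (k + 1) (1 : ℂ) : EllTwo) n) n = _
  simp only [lp.coeFn_add, lp.coeFn_smul, Pi.add_apply, Pi.smul_apply, smul_eq_mul,
    lp.single_apply]
  rcases n with _ | n
  · simp [jacobiAction, Pi.single_apply]
    grind
  · simp [jacobiAction, Pi.single_apply]
    grind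

theorem linearIndependent_single :
    LinearIndependent ℂ fun n : ℕ => (lp.single 2 n (1 : ℂ) : EllTwo) := by
  have h := (HilbertBasis.ofRepr (LinearIsometryEquiv.refl ℂ EllTwo)).orthonormal
  have h2 : (fun n : ℕ => (lp.single 2 n (1 : ℂ) : EllTwo)) =
      HilbertBasis.ofRepr (LinearIsometryEquiv.refl ℂ EllTwo) := by
    funext n
    rw [← HilbertBasis.repr_symm_single]
    rfl
  rw [h2]
  exact h.linearIndependent

/-- A spectral measure of a Jacobi operator is not supported on a finite set. -/
theorem IsJacobiSpectralMeasure.measure_compl_ne_zero {a b : ℕ → ℝ} (ha : ∀ n, 0 < a n)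
    {ρ : Measure ℝ} (h : IsJacobiSpectralMeasure a b ρ) {F : Set ℝ} (hF : F.Finite) :
    ρ Fᶜ ≠ 0 := by
  obtain ⟨T, hJT, hT, E, hE, rfl⟩ := h
  lift F to Finset ℝ using hF
  intro h0
  set w : Set EllTwo := (fun l => E.proj {l} ellTwoFirst) '' (F : Set ℝ) with hw
  have hfin : w.Finite := F.finite_toSet.image _
  have hinv : ∀ x ∈ Submodule.span ℂ w, ∃ hx : x ∈ T.domain, T ⟨x, hx⟩ ∈ Submodule.span ℂ w := by
    intro x hx
    induction hx using Submodule.span_induction with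
    | mem x hx =>
      obtain ⟨l, hl, rfl⟩ := hx
      refine ⟨hE.proj_singleton_mem l _, ?_⟩
      simp only
      rw [hE.apply_proj_singleton hT.dense_domain]
      exact Submodule.smul_mem _ _ (Submodule.subset_span ⟨l, hl, rfl⟩)
    | zero => exact ⟨T.domain.zero_mem, by
        have : (⟨0, T.domain.zero_mem⟩ : T.domain) = 0 := rfl
        rw [this, LinearPMap.map_zero]
        exact Submodule.zero_mem _⟩
    | add x y _ _ hx hy =>
      obtain ⟨hx, hx'⟩ := hx
      obtain ⟨hy, hy'⟩ := hy
      refine ⟨T.domain.add_mem hx hy, ?_⟩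
      have : (⟨x + y, T.domain.add_mem hx hy⟩ : T.domain) = ⟨x, hx⟩ + ⟨y, hy⟩ := rfl
      rw [this, LinearPMap.map_add]
      exact Submodule.add_mem _ hx' hy'
    | smul c x _ hx =>
      obtain ⟨hx, hx'⟩ := hx
      refine ⟨T.domain.smul_mem c hx, ?_⟩
      have : (⟨c • x, T.domain.smul_mem c hx⟩ : T.domain) = c • ⟨x, hx⟩ := rfl
      rw [this, LinearPMap.map_smul]
      exact Submodule.smul_mem _ _ hx'
  have hJ : ∀ n, (lp.single 2 n (1 : ℂ) : EllTwo) ∈ Submodule.span ℂ w →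
      jacobiOperator a b ⟨lp.single 2 n (1 : ℂ), single_mem_finiteSequences n⟩ ∈
        Submodule.span ℂ w := by
    intro n hn
    obtain ⟨hd, hm⟩ := hinv _ hn
    rw [hJT.2 (x := ⟨lp.single 2 n (1 : ℂ), single_mem_finiteSequences n⟩) (y := ⟨_, hd⟩) rfl]
    exact hm
  have hcancel : ∀ (n : ℕ) (x : EllTwo), (a n : ℂ) • x ∈ Submodule.span ℂ w →
      x ∈ Submodule.span ℂ w := fun n x hx =>
    (Submodule.smul_mem_iff _ (Complex.ofReal_ne_zero.2 (ha n).ne')).1 hx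
  -- The three-term recurrence expresses `a n` times the next basis vector through earlier ones and
  -- an image under the operator; two consecutive vectors must be carried along.
  have hall : ∀ n, (lp.single 2 n (1 : ℂ) : EllTwo) ∈ Submodule.span ℂ w ∧
      (lp.single 2 (n + 1) (1 : ℂ) : EllTwo) ∈ Submodule.span ℂ w := by
    intro n
    induction n with
    | zero =>
      have h1 : (lp.single 2 0 (1 : ℂ) : EllTwo) ∈ Submodule.span ℂ w := by
        change ellTwoFirst ∈ _
        rw [E.eq_sum_proj_singleton h0]
        exact Submodule.sum_mem _ fun l hl => Submodule.subset_span ⟨l, hl, rfl⟩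
      refine ⟨h1, hcancel 0 _ ?_⟩
      have h2 := hJ 0 h1
      rw [jacobiOperator_single_zero] at h2
      exact (Submodule.add_mem_iff_right _ (Submodule.smul_mem _ _ h1)).1 h2
    | succ n ih =>
      refine ⟨ih.2, hcancel (n + 1) _ ?_⟩
      have h2 := hJ (n + 1) ih.2
      rw [jacobiOperator_single_succ] at h2
      exact (Submodule.add_mem_iff_right _ (Submodule.add_mem _ (Submodule.smul_mem _ _ ih.1)
        (Submodule.smul_mem _ _ ih.2))).1 h2
  have := hfin.to_subtype
  have : Finite ℕ := linearIndependent_single.finite_of_le_span_finite _ w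
    (by
      rintro _ ⟨n, rfl⟩
      exact (hall n).1)
  exact not_finite ℕ

theorem norm_ellTwoFirst : ‖ellTwoFirst‖ = 1 := by
  rw [ellTwoFirst, lp.norm_single (by norm_num), norm_one]

theorem IsJacobiSpectralMeasure.measure_univ {a b : ℕ → ℝ} {ρ : Measure ℝ}
    (h : IsJacobiSpectralMeasure a b ρ) : ρ Set.univ = 1 := by
  obtain ⟨T, -, -, E, -, rfl⟩ := h
  rw [E.scalarMeasure_univ, norm_ellTwoFirst, one_pow, ENNReal.ofReal_one]

end Jacobi

/-! ### Strong sums of projections and unitary transport. -/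

section Transport

variable {H K : Type*} [NormedAddCommGroup H] [InnerProductSpace ℂ H] [CompleteSpace H]
  [NormedAddCommGroup K] [InnerProductSpace ℂ K] [CompleteSpace K]

/-- A star projection `P` is the strong sum of star projections `P i ≤ P` with orthogonal ranges as
soon as the squared norms add up. -/
theorem hasSum_apply_of_isStarProjection {P : H →L[ℂ] H} {Q : ℕ → H →L[ℂ] H}
    (hP : IsStarProjection P) (hQ : ∀ i, IsStarProjection (Q i)) (hPQ : ∀ i x, P (Q i x) = Q i x)
    (hQQ : ∀ i j x, i ≠ j → Q i (Q j x) = 0) {x : H}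
    (h : HasSum (fun i => ‖Q i x‖ ^ 2) (‖P x‖ ^ 2)) : HasSum (fun i => Q i x) (P x) := by
  have hsymm : ∀ (R : H →L[ℂ] H), IsStarProjection R → ∀ u v, inner ℂ (R u) v = inner ℂ u (R v) :=
    fun R hR u v => hR.isSelfAdjoint.isSymmetric u v
  have h1 : ∀ s : Finset ℕ, inner ℂ (P x) (∑ i ∈ s, Q i x) = ((∑ i ∈ s, ‖Q i x‖ ^ 2 : ℝ) : ℂ) := by
    intro s
    rw [inner_sum, Complex.ofReal_sum]
    refine Finset.sum_congr rfl fun i _ => ?_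
    rw [hsymm P hP, hPQ, (hQ i).inner_apply_self]
  have h2 : ∀ s : Finset ℕ, inner ℂ (∑ i ∈ s, Q i x) (∑ i ∈ s, Q i x) =
      ((∑ i ∈ s, ‖Q i x‖ ^ 2 : ℝ) : ℂ) := by
    intro s
    rw [inner_sum, Complex.ofReal_sum]
    refine Finset.sum_congr rfl fun i hi => ?_
    rw [sum_inner, Finset.sum_eq_single_of_mem i hi]
    · rw [inner_self_eq_norm_sq_to_K]
      norm_cast
    · intro j _ hji
      rw [hsymm _ (hQ j), hQQ j i x hji, inner_zero_right]
  -- Pythagoras: the squared error of a partial sum is the missing part of the squared norm.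
  have h3 : ∀ s : Finset ℕ, ‖(∑ i ∈ s, Q i x) - P x‖ ^ 2 = ‖P x‖ ^ 2 - ∑ i ∈ s, ‖Q i x‖ ^ 2 := by
    intro s
    have h4 : ‖∑ i ∈ s, Q i x‖ ^ 2 = ∑ i ∈ s, ‖Q i x‖ ^ 2 := by
      have := h2 s
      rw [inner_self_eq_norm_sq_to_K] at this
      apply Complex.ofReal_injective
      rw [← this, Complex.ofReal_pow]
      rfl
    rw [norm_sub_rev, norm_sub_sq (𝕜 := ℂ), h1, h4, RCLike.re_eq_complex_re, Complex.ofReal_re]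
    ring
  have h5 : Filter.Tendsto (fun s : Finset ℕ => ‖(∑ i ∈ s, Q i x) - P x‖ ^ 2) Filter.atTop
      (nhds 0) := by
    simp only [h3]
    have := (tendsto_const_nhds (x := ‖P x‖ ^ 2)).sub h
    rwa [sub_self] at this
  have h6 : Filter.Tendsto (fun s : Finset ℕ => ‖(∑ i ∈ s, Q i x) - P x‖) Filter.atTop
      (nhds 0) := by
    have := h5.sqrt
    simpa [Real.sqrt_sq] using this
  exact tendsto_iff_norm_sub_tendsto_zero.2 h6

namespace ProjValuedMeasure

/-- The transport of a projection-valued measure along a unitary. -/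
noncomputable def map (E : ProjValuedMeasure H) (U : H ≃ₗᵢ[ℂ] K) : ProjValuedMeasure K where
  proj B := U.conjStarAlgEquiv (E.proj B)
  isStarProjection B hB := (E.isStarProjection B hB).map U.conjStarAlgEquiv
  proj_univ := by rw [E.proj_univ, map_one]
  hasSum_proj f hf hd x := by
    simp only [LinearIsometryEquiv.conjStarAlgEquiv_apply_apply]
    exact (E.hasSum_proj f hf hd (U.symm x)).mapL U.toContinuousLinearEquiv.toContinuousLinearMap

theorem scalarMeasure_map (E : ProjValuedMeasure H) (U : H ≃ₗᵢ[ℂ] K) (x : K) :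
    (E.map U).scalarMeasure x = E.scalarMeasure (U.symm x) := by
  ext B hB
  rw [scalarMeasure_apply _ _ hB, scalarMeasure_apply _ _ hB]
  change ENNReal.ofReal (inner ℂ x (U (E.proj B (U.symm x)))).re = _
  rw [← U.inner_map_map (U.symm x), U.apply_symm_apply]

theorem isSpectralMeasureOf_toPMap_top {E : ProjValuedMeasure H} {S : H →L[ℂ] H}
    (h1 : ∀ x, ∫⁻ t, ENNReal.ofReal (t ^ 2) ∂(E.scalarMeasure x) < ⊤)
    (h2 : ∀ x, inner ℂ x (S x) = ((∫ t, t ∂(E.scalarMeasure x) : ℝ) : ℂ)) :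
    E.IsSpectralMeasureOf ((S : H →ₗ[ℂ] H).toPMap ⊤) :=
  ⟨fun x => ⟨fun _ => h1 x, fun _ => Submodule.mem_top⟩, fun x => h2 x⟩

end ProjValuedMeasure

theorem IsSelfAdjoint.toPMap_top {S : H →L[ℂ] H} (hS : IsSelfAdjoint S) :
    IsSelfAdjoint ((S : H →ₗ[ℂ] H).toPMap ⊤) := by
  rw [LinearPMap.isSelfAdjoint_def,
    ContinuousLinearMap.toPMap_adjoint_eq_adjoint_toPMap_of_dense S (by simp),
    ContinuousLinearMap.isSelfAdjoint_iff'.1 hS]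

end Transport

/-! ### From a cyclic vector to a Jacobi matrix. -/

section GramSchmidtJacobi

open InnerProductSpace Submodule

variable {H : Type*} [NormedAddCommGroup H] [InnerProductSpace ℂ H]

theorem inner_gramSchmidt_eq_zero (f : ℕ → H) {n : ℕ} {x : H}
    (hx : x ∈ span ℂ (f '' Set.Iio n)) : inner ℂ (gramSchmidt ℂ f n) x = 0 := by
  induction hx using Submodule.span_induction with
  | mem x hx =>
    obtain ⟨i, hi, rfl⟩ := hx
    exact gramSchmidt_inv_triangular ℂ f hi
  | zero => exact inner_zero_right _
  | add x y _ _ hx hy => rw [inner_add_right, hx, hy, add_zero]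
  | smul c x _ hx => rw [inner_smul_right, hx, mul_zero]

theorem sub_gramSchmidt_mem_span (f : ℕ → H) (n : ℕ) :
    f n - gramSchmidt ℂ f n ∈ span ℂ (f '' Set.Iio n) := by
  rw [gramSchmidt_def ℂ f n, sub_sub_cancel, ← span_gramSchmidt_Iio]
  refine Submodule.sum_mem _ fun i hi => ?_
  have h1 : ℂ ∙ gramSchmidt ℂ f i ≤ span ℂ (gramSchmidt ℂ f '' Set.Iio n) :=
    span_mono (Set.singleton_subset_iff.2 ⟨i, Finset.mem_Iio.1 hi, rfl⟩)
  exact h1 (Submodule.starProjection_apply_mem _ _)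

theorem inner_gramSchmidt_self (f : ℕ → H) (n : ℕ) :
    inner ℂ (gramSchmidt ℂ f n) (f n) = ((‖gramSchmidt ℂ f n‖ ^ 2 : ℝ) : ℂ) := by
  have h := inner_gramSchmidt_eq_zero f (sub_gramSchmidt_mem_span f n)
  rw [inner_sub_right, sub_eq_zero] at h
  rw [h, inner_self_eq_norm_sq_to_K]
  norm_cast

variable {M : H →L[ℂ] H} {f : ℕ → H}

theorem map_mem_span_Iio (hM : ∀ n, M (f n) = f (n + 1)) {n : ℕ} {x : H}
    (hx : x ∈ span ℂ (f '' Set.Iio n)) : M x ∈ span ℂ (f '' Set.Iio (n + 1)) := by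
  induction hx using Submodule.span_induction with
  | mem x hx =>
    obtain ⟨i, hi, rfl⟩ := hx
    rw [hM]
    exact subset_span ⟨i + 1, Nat.succ_lt_succ hi, rfl⟩
  | zero => rw [map_zero]; exact zero_mem _
  | add x y _ _ hx hy => rw [map_add]; exact add_mem hx hy
  | smul c x _ hx => rw [map_smul]; exact smul_mem _ c hx

/-- Modulo the span of `f 0, …, f n`, to which `gramSchmidt ℂ f (n + 1)` is orthogonal, `M` sends
the `n`-th Gram–Schmidt vector to `f (n + 1)`. This makes the off-diagonal entries positive. -/
theorem inner_gramSchmidt_map_succ (hM : ∀ n, M (f n) = f (n + 1)) (n : ℕ) :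
    inner ℂ (gramSchmidt ℂ f (n + 1)) (M (gramSchmidt ℂ f n)) =
      ((‖gramSchmidt ℂ f (n + 1)‖ ^ 2 : ℝ) : ℂ) := by
  have h := inner_gramSchmidt_eq_zero f (map_mem_span_Iio hM (sub_gramSchmidt_mem_span f n))
  rw [map_sub, hM, inner_sub_right, sub_eq_zero] at h
  rw [← h, inner_gramSchmidt_self]

/-- `M` raises the filtration by spans by one step only; with self-adjointness this makes the matrix
tridiagonal. -/
theorem inner_gramSchmidt_map_of_lt (hM : ∀ n, M (f n) = f (n + 1)) {m n : ℕ} (h : n + 1 < m) :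
    inner ℂ (gramSchmidt ℂ f m) (M (gramSchmidt ℂ f n)) = 0 := by
  have h1 : gramSchmidt ℂ f n ∈ span ℂ (f '' Set.Iio (n + 1)) := by
    rw [← span_gramSchmidt_Iio]
    exact subset_span ⟨n, Nat.lt_succ_self n, rfl⟩
  exact inner_gramSchmidt_eq_zero f
    (span_mono (Set.image_mono (Set.Iio_subset_Iio h)) (map_mem_span_Iio hM h1))

/-- A bounded self-adjoint operator with cyclic vector `f 0`, whose iterates `f n` are linearly
independent, is unitarily equivalent to a Jacobi operator. -/
theorem exists_jacobi_of_cyclic [CompleteSpace H] (hS : IsSelfAdjoint M)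
    (hM : ∀ n, M (f n) = f (n + 1)) (hf : LinearIndependent ℂ f)
    (hd : (span ℂ (Set.range f)).topologicalClosure = ⊤) (h0 : ‖f 0‖ = 1) :
    ∃ (a b : ℕ → ℝ) (U : H ≃ₗᵢ[ℂ] EllTwo), (∀ n, 0 < a n) ∧ U.symm ellTwoFirst = f 0 ∧
      ∀ (θ : EllTwo) (n : ℕ), (U (M (U.symm θ))) n = jacobiAction a b θ n := by
  set g := gramSchmidt ℂ f with hg
  set v := gramSchmidtNormed ℂ f with hv
  have hvg : ∀ n, v n = ((‖g n‖⁻¹ : ℝ) : ℂ) • g n := fun n => by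
    rw [Complex.ofReal_inv]
    rfl
  have hgpos : ∀ n, 0 < ‖g n‖ := fun n => norm_pos_iff.2 (gramSchmidt_ne_zero n hf)
  have hort : Orthonormal ℂ v := gramSchmidtNormed_orthonormal hf
  let B : HilbertBasis ℕ ℂ H := HilbertBasis.mk hort (by
    rw [hv, span_gramSchmidtNormed_range, span_gramSchmidt, hd])
  have hB : ∀ n, B n = v n := fun n => congrFun (HilbertBasis.coe_mk _ _) n
  have hsymm : ∀ x y, inner ℂ (M x) y = inner ℂ x (M y) := fun x y => hS.isSymmetric x y
  -- The entry `‖g (n + 1)‖²` divided by the normalizations `‖g n‖ * ‖g (n + 1)‖`.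
  let a : ℕ → ℝ := fun n => ‖g (n + 1)‖ / ‖g n‖
  let b : ℕ → ℝ := fun n => (inner ℂ (v n) (M (v n))).re
  have hJ1 : ∀ n, inner ℂ (v (n + 1)) (M (v n)) = (a n : ℂ) := by
    intro n
    rw [hvg, hvg, map_smul, inner_smul_left, inner_smul_right, inner_gramSchmidt_map_succ hM,
      Complex.conj_ofReal]
    norm_cast
    have := (hgpos n).ne'
    have := (hgpos (n + 1)).ne'
    simp only [a, ← hg]
    field_simp
  have hJ1' : ∀ n, inner ℂ (v n) (M (v (n + 1))) = (a n : ℂ) := by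
    intro n
    rw [← hsymm, ← inner_conj_symm, hJ1, Complex.conj_ofReal]
  have hJ0 : ∀ m n, n + 1 < m → inner ℂ (v m) (M (v n)) = 0 := by
    intro m n h
    rw [hvg, hvg, map_smul, inner_smul_left, inner_smul_right, inner_gramSchmidt_map_of_lt hM h,
      mul_zero, mul_zero]
  have hJ0' : ∀ m n, n + 1 < m → inner ℂ (v n) (M (v m)) = 0 := by
    intro m n h
    rw [← hsymm, ← inner_conj_symm, hJ0 m n h, map_zero]
  have hJb : ∀ n, inner ℂ (v n) (M (v n)) = (b n : ℂ) := by
    intro n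
    refine (Complex.conj_eq_iff_re.1 ?_).symm
    rw [inner_conj_symm, hsymm]
  have hvv : ∀ m n, inner ℂ (v m) (v n) = if m = n then (1 : ℂ) else 0 :=
    orthonormal_iff_ite.1 hort
  have hext : ∀ x y : H, (∀ m, inner ℂ (v m) x = inner ℂ (v m) y) → x = y := by
    intro x y h
    apply B.repr.injective
    ext m
    rw [B.repr_apply_apply, B.repr_apply_apply, hB, h]
  have hM0 : M (v 0) = (b 0 : ℂ) • v 0 + (a 0 : ℂ) • v 1 := by
    refine hext _ _ fun m => ?_
    rw [inner_add_right, inner_smul_right, inner_smul_right, hvv, hvv]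
    rcases m with _ | _ | m
    · simp [hJb]
    · simp [hJ1]
    · simp [hJ0 (m + 1 + 1) 0 (by omega)]
  have hMs : ∀ n, M (v (n + 1)) =
      (a (n + 1) : ℂ) • v (n + 2) + (a n : ℂ) • v n + (b (n + 1) : ℂ) • v (n + 1) := by
    intro n
    refine hext _ _ fun m => ?_
    rw [inner_add_right, inner_add_right, inner_smul_right, inner_smul_right, inner_smul_right,
      hvv, hvv, hvv]
    rcases lt_trichotomy m (n + 1) with h | rfl | h
    · rcases (Nat.lt_succ_iff.1 h).lt_or_eq with h | rfl
      · rw [hJ0' (n + 1) m (by omega), if_neg (by omega), if_neg (by omega), if_neg (by omega)]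
        simp
      · rw [hJ1', if_neg (by omega), if_pos rfl, if_neg (by omega)]
        simp
    · rw [hJb, if_neg (by omega), if_neg (by omega), if_pos rfl]
      simp
    · rcases (Nat.succ_le_iff.2 h).lt_or_eq with h | rfl
      · rw [hJ0 m (n + 1) (by omega), if_neg (by omega), if_neg (by omega), if_neg (by omega)]
        simp
      · rw [hJ1 (n + 1), if_pos rfl, if_neg (by omega), if_neg (by omega)]
        simp
  refine ⟨a, b, B.repr, fun n => div_pos (hgpos _) (hgpos _), ?_, fun θ n => ?_⟩
  · have : v 0 = f 0 := by
      have h1 : g 0 = f 0 := gramSchmidt_bot ℂ f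
      rw [hvg, h1, h0, inv_one, Complex.ofReal_one, one_smul]
    rw [ellTwoFirst, B.repr_symm_single, hB, this]
  · have hc : ∀ m, inner ℂ (v m) (B.repr.symm θ) = θ m := by
      intro m
      rw [← hB, ← B.repr_apply_apply, LinearIsometryEquiv.apply_symm_apply]
    -- Moving `M` onto the basis vector avoids expanding `M` on an infinite series.
    rw [B.repr_apply_apply, hB, ← hsymm]
    rcases n with _ | n
    · rw [hM0, inner_add_left, inner_smul_left, inner_smul_left, hc, hc, Complex.conj_ofReal,
        Complex.conj_ofReal, jacobiAction]
    · rw [hMs, inner_add_left, inner_add_left, inner_smul_left, inner_smul_left, inner_smul_left,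
        hc, hc, hc, Complex.conj_ofReal, Complex.conj_ofReal, Complex.conj_ofReal, jacobiAction]

theorem jacobiOperator_le_toPMap_top {a b : ℕ → ℝ} {S : EllTwo →L[ℂ] EllTwo}
    (h : ∀ (θ : EllTwo) (n : ℕ), S θ n = jacobiAction a b θ n) :
    jacobiOperator a b ≤ (S : EllTwo →ₗ[ℂ] EllTwo).toPMap ⊤ := by
  refine ⟨fun x _ => Submodule.mem_top, fun x y hxy => ?_⟩
  ext n
  change jacobiAction a b (fun n => (x : EllTwo) n) n = S y n
  rw [h, hxy]

end GramSchmidtJacobi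

noncomputable section

/-! ### Multiplication operators on `L²(ρ)` and their spectral measure. -/

section MulOperator

/-- Multiplication by the essentially bounded function `g` on `L²(ρ)`. -/
def mulOperator (ρ : Measure ℝ) (g : ℝ → ℝ) : Lp ℂ 2 ρ →L[ℂ] Lp ℂ 2 ρ :=
  open Classical in
  if h : MemLp (fun t => (g t : ℂ)) ∞ ρ then
    (ContinuousLinearMap.mul ℂ ℂ).holderL ρ ∞ 2 2 (h.toLp _)
  else 0

variable {ρ : Measure ℝ} {g k : ℝ → ℝ}

theorem coeFn_mulOperator (h : MemLp (fun t => (g t : ℂ)) ∞ ρ) (x : Lp ℂ 2 ρ) :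
    mulOperator ρ g x =ᵐ[ρ] fun t => g t * x t := by
  rw [mulOperator, dif_pos h]
  filter_upwards [(ContinuousLinearMap.mul ℂ ℂ).coeFn_holder (r := 2) (h.toLp _) x, h.coeFn_toLp]
    with t h1 h2
  rw [ContinuousLinearMap.holderL_apply_apply, h1, h2, ContinuousLinearMap.mul_apply']

theorem mulOperator_mulOperator (hg : MemLp (fun t => (g t : ℂ)) ∞ ρ)
    (hk : MemLp (fun t => (k t : ℂ)) ∞ ρ) (hgk : MemLp (fun t => ((g * k) t : ℂ)) ∞ ρ)
    (x : Lp ℂ 2 ρ) : mulOperator ρ g (mulOperator ρ k x) = mulOperator ρ (g * k) x := by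
  apply Lp.ext
  filter_upwards [coeFn_mulOperator hg (mulOperator ρ k x), coeFn_mulOperator hk x,
    coeFn_mulOperator hgk x] with t h1 h2 h3
  rw [h1, h2, h3, Pi.mul_apply, Complex.ofReal_mul, mul_assoc]

theorem isSelfAdjoint_mulOperator (h : MemLp (fun t => (g t : ℂ)) ∞ ρ) :
    IsSelfAdjoint (mulOperator ρ g) := by
  rw [ContinuousLinearMap.isSelfAdjoint_iff_isSymmetric]
  intro x y
  simp only [ContinuousLinearMap.coe_coe, L2.inner_def]
  refine integral_congr_ae ?_
  filter_upwards [coeFn_mulOperator h x, coeFn_mulOperator h y] with t h1 h2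
  rw [h1, h2]
  simp only [RCLike.inner_apply, map_mul, Complex.conj_ofReal]
  ring

theorem inner_mulOperator_self (h : MemLp (fun t => (g t : ℂ)) ∞ ρ) (x : Lp ℂ 2 ρ) :
    inner ℂ x (mulOperator ρ g x) = ((∫ t, g t * ‖x t‖ ^ 2 ∂ρ : ℝ) : ℂ) := by
  rw [L2.inner_def, ← integral_complex_ofReal]
  refine integral_congr_ae ?_
  filter_upwards [coeFn_mulOperator h x] with t h1
  rw [h1, RCLike.inner_apply, mul_assoc, Complex.mul_conj, Complex.normSq_eq_norm_sq]
  norm_cast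

end MulOperator

section Indicator

variable (ρ : Measure ℝ)

theorem memLp_top_indicator_one {B : Set ℝ} (hB : MeasurableSet B) :
    MemLp (fun t => ((B.indicator (1 : ℝ → ℝ) t : ℝ) : ℂ)) ∞ ρ := by
  refine memLp_top_of_bound ?_ 1 (ae_of_all _ fun t => ?_)
  · exact (Complex.measurable_ofReal.comp (measurable_one.indicator hB)).aestronglyMeasurable
  · by_cases ht : t ∈ B <;> simp [ht]

theorem mulOperator_indicator_mulOperator_indicator {A B : Set ℝ} (hA : MeasurableSet A)
    (hB : MeasurableSet B) (x : Lp ℂ 2 ρ) :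
    mulOperator ρ (A.indicator 1) (mulOperator ρ (B.indicator 1) x) =
      mulOperator ρ ((A ∩ B).indicator 1) x := by
  have h : (A ∩ B).indicator (1 : ℝ → ℝ) = A.indicator 1 * B.indicator 1 :=
    Set.inter_indicator_one
  rw [h, mulOperator_mulOperator (memLp_top_indicator_one ρ hA) (memLp_top_indicator_one ρ hB)]
  rw [← h]
  exact memLp_top_indicator_one ρ (hA.inter hB)

theorem mulOperator_indicator_univ : mulOperator ρ (Set.univ.indicator 1) = 1 := by
  ext1 x
  apply Lp.ext
  filter_upwards [coeFn_mulOperator (memLp_top_indicator_one ρ MeasurableSet.univ) x] with t h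
  rw [h]
  simp

theorem mulOperator_indicator_empty : mulOperator ρ ((∅ : Set ℝ).indicator 1) = 0 := by
  ext1 x
  apply Lp.ext
  filter_upwards [coeFn_mulOperator (memLp_top_indicator_one ρ MeasurableSet.empty) x,
    Lp.coeFn_zero ℂ 2 ρ] with t h h0
  rw [h, zero_apply, h0]
  simp

theorem isStarProjection_mulOperator_indicator {B : Set ℝ} (hB : MeasurableSet B) :
    IsStarProjection (mulOperator ρ (B.indicator 1)) where
  isSelfAdjoint := isSelfAdjoint_mulOperator (memLp_top_indicator_one ρ hB)
  isIdempotentElem := by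
    ext1 x
    rw [mul_apply_eq_comp, mulOperator_indicator_mulOperator_indicator ρ hB hB,
      Set.inter_self]

theorem integrable_norm_sq (x : Lp ℂ 2 ρ) : Integrable (fun t => ‖x t‖ ^ 2) ρ :=
  (memLp_two_iff_integrable_sq_norm (Lp.aestronglyMeasurable x)).1 (Lp.memLp x)

theorem inner_mulOperator_indicator {B : Set ℝ} (hB : MeasurableSet B) (x : Lp ℂ 2 ρ) :
    inner ℂ x (mulOperator ρ (B.indicator 1) x) = ((∫ t in B, ‖x t‖ ^ 2 ∂ρ : ℝ) : ℂ) := by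
  rw [inner_mulOperator_self (memLp_top_indicator_one ρ hB), ← integral_indicator hB]
  congr 2
  funext t
  by_cases ht : t ∈ B <;> simp [ht]

/-- The projection-valued measure `B ↦ 1_B` on `L²(ρ)`. -/
def mulProjValuedMeasure : ProjValuedMeasure (Lp ℂ 2 ρ) where
  proj B := mulOperator ρ (B.indicator 1)
  isStarProjection _ hB := isStarProjection_mulOperator_indicator ρ hB
  proj_univ := mulOperator_indicator_univ ρ
  hasSum_proj f hf hd x := by
    have hU := MeasurableSet.iUnion hf
    have hnorm : ∀ B : Set ℝ, MeasurableSet B →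
        ‖mulOperator ρ (B.indicator 1) x‖ ^ 2 = ∫ t in B, ‖x t‖ ^ 2 ∂ρ := by
      intro B hB
      apply Complex.ofReal_injective
      rw [← inner_mulOperator_indicator ρ hB,
        (isStarProjection_mulOperator_indicator ρ hB).inner_apply_self]
    refine hasSum_apply_of_isStarProjection (isStarProjection_mulOperator_indicator ρ hU)
      (fun i => isStarProjection_mulOperator_indicator ρ (hf i)) (fun i y => ?_)
      (fun i j y hij => ?_) ?_
    · rw [mulOperator_indicator_mulOperator_indicator ρ hU (hf i),
        Set.inter_eq_self_of_subset_right (Set.subset_iUnion f i)]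
    · rw [mulOperator_indicator_mulOperator_indicator ρ (hf i) (hf j), (hd hij).inter_eq,
        mulOperator_indicator_empty, zero_apply]
    · rw [hnorm _ hU]
      simp only [hnorm _ (hf _)]
      exact hasSum_integral_iUnion hf hd (integrable_norm_sq ρ x).integrableOn

theorem scalarMeasure_mulProjValuedMeasure (x : Lp ℂ 2 ρ) :
    (mulProjValuedMeasure ρ).scalarMeasure x =
      ρ.withDensity fun t => ENNReal.ofReal (‖x t‖ ^ 2) := by
  ext B hB
  rw [ProjValuedMeasure.scalarMeasure_apply _ _ hB, withDensity_apply _ hB,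
    ← ofReal_integral_eq_lintegral_ofReal (integrable_norm_sq ρ x).integrableOn
      (ae_of_all _ fun t => sq_nonneg _)]
  congr 1
  change (inner ℂ x (mulOperator ρ (B.indicator 1) x)).re = _
  rw [inner_mulOperator_indicator ρ hB, Complex.ofReal_re]

end Indicator

/-! ### Measures on `[0, 1]` as Jacobi spectral measures. -/

section UnitInterval

variable {ρ : Measure ℝ}

theorem memLp_of_continuous [IsFiniteMeasure ρ] (hρ : ρ (Set.Icc 0 1)ᶜ = 0) {g : ℝ → ℂ} (hg : Continuous g) (p : ℝ≥0∞) :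
    MemLp g p ρ := by
  obtain ⟨C, hC⟩ := isCompact_Icc.exists_bound_of_continuousOn
    (s := Set.Icc (0 : ℝ) 1) hg.continuousOn
  have hae : ∀ᵐ t ∂ρ, t ∈ Set.Icc (0 : ℝ) 1 := hρ
  exact MemLp.of_bound hg.aestronglyMeasurable C (hae.mono hC)

theorem integral_scalarMeasure_mulProjValuedMeasure (g : ℝ → ℝ) (x : Lp ℂ 2 ρ) :
    ∫ t, g t ∂((mulProjValuedMeasure ρ).scalarMeasure x) = ∫ t, g t * ‖x t‖ ^ 2 ∂ρ := by
  rw [scalarMeasure_mulProjValuedMeasure, integral_withDensity_eq_integral_toReal_smul₀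
    (integrable_norm_sq ρ x).aestronglyMeasurable.aemeasurable.ennreal_ofReal
    (ae_of_all _ fun t => ENNReal.ofReal_lt_top)]
  refine integral_congr_ae (ae_of_all _ fun t => ?_)
  simp only [ENNReal.toReal_ofReal (sq_nonneg _), smul_eq_mul, mul_comm]

theorem lintegral_sq_scalarMeasure_lt_top (hρ : ρ (Set.Icc 0 1)ᶜ = 0) (x : Lp ℂ 2 ρ) :
    ∫⁻ t, ENNReal.ofReal (t ^ 2) ∂((mulProjValuedMeasure ρ).scalarMeasure x) < ⊤ := by
  have hae : ∀ᵐ t ∂((mulProjValuedMeasure ρ).scalarMeasure x), t ∈ Set.Icc (0 : ℝ) 1 := by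
    rw [scalarMeasure_mulProjValuedMeasure]
    exact withDensity_absolutelyContinuous _ _ hρ
  have hle : ∫⁻ t, ENNReal.ofReal (t ^ 2) ∂((mulProjValuedMeasure ρ).scalarMeasure x) ≤
      ∫⁻ _, 1 ∂((mulProjValuedMeasure ρ).scalarMeasure x) := by
    refine lintegral_mono_ae ?_
    filter_upwards [hae] with t ht
    rw [← ENNReal.ofReal_one]
    exact ENNReal.ofReal_le_ofReal (pow_le_one₀ ht.1 ht.2)
  refine hle.trans_lt ?_
  rw [lintegral_one]
  exact measure_lt_top _ _

open Polynomial

/-- The polynomials as elements of `L²(ρ)`. -/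
def polynomialToLp [IsFiniteMeasure ρ] (hρ : ρ (Set.Icc 0 1)ᶜ = 0) : ℂ[X] →ₗ[ℂ] Lp ℂ 2 ρ where
  toFun p := (memLp_of_continuous hρ (g := fun t : ℝ => p.eval (t : ℂ)) (by fun_prop) 2).toLp
  map_add' p q := by
    rw [← MemLp.toLp_add]
    simp only [eval_add]
    rfl
  map_smul' c p := by
    rw [RingHom.id_apply, ← MemLp.toLp_const_smul]
    simp only [eval_smul]
    rfl

theorem coeFn_polynomialToLp [IsFiniteMeasure ρ] (hρ : ρ (Set.Icc 0 1)ᶜ = 0) (p : ℂ[X]) :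
    polynomialToLp hρ p =ᵐ[ρ] fun t : ℝ => p.eval (t : ℂ) :=
  MemLp.coeFn_toLp (memLp_of_continuous hρ (by fun_prop) 2)

/-- A nonzero polynomial that vanishes almost everywhere would confine `ρ` to its finitely many
roots. -/
theorem polynomialToLp_injective [IsFiniteMeasure ρ] (hρ : ρ (Set.Icc 0 1)ᶜ = 0) (hF : ∀ F : Set ℝ, F.Finite → ρ Fᶜ ≠ 0) :
    Function.Injective (polynomialToLp hρ) := by
  rw [injective_iff_map_eq_zero]
  intro p hp
  by_contra hne
  refine hF ((fun t : ℝ => (t : ℂ)) ⁻¹' {z | p.IsRoot z})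
    ((finite_setOfPred_isRoot hne).preimage Complex.ofReal_injective.injOn) ?_
  have h : ∀ᵐ t ∂ρ, p.IsRoot ((t : ℝ) : ℂ) := by
    filter_upwards [coeFn_polynomialToLp hρ p, Lp.coeFn_zero ℂ 2 ρ] with t h1 h2
    rw [hp, h2] at h1
    exact h1.symm
  exact h

theorem toLp_ofReal_mem_closure_range [IsFiniteMeasure ρ] (hρ : ρ (Set.Icc 0 1)ᶜ = 0) {u : ℝ → ℝ} (hu : Continuous u) :
    (memLp_of_continuous hρ (g := fun t => (u t : ℂ)) (by fun_prop) 2).toLp ∈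
      (LinearMap.range (polynomialToLp hρ)).topologicalClosure := by
  change _ ∈ closure (LinearMap.range (polynomialToLp hρ) : Set (Lp ℂ 2 ρ))
  rw [Metric.mem_closure_iff]
  intro ε hε
  -- `C = ρ(ℝ)^(1/2)` bounds the `L²` norm by the sup norm on `[0, 1]`.
  set C : ℝ := (measureUnivNNReal ρ : ℝ) ^ (2 : ℝ≥0∞).toReal⁻¹ with hC
  have hC0 : 0 ≤ C := by positivity
  obtain ⟨p, hp⟩ := exists_polynomial_near_of_continuousOn 0 1 u hu.continuousOn (ε / (C + 1))
    (by positivity)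
  refine ⟨_, ⟨p.map Complex.ofRealHom, rfl⟩, ?_⟩
  have hae : ∀ᵐ t ∂ρ, t ∈ Set.Icc (0 : ℝ) 1 := hρ
  set x := (memLp_of_continuous hρ (g := fun t => (u t : ℂ)) (by fun_prop) 2).toLp with hx
  have hle : ‖x - polynomialToLp hρ (p.map Complex.ofRealHom)‖ ≤ C * (ε / (C + 1)) := by
    refine Lp.norm_le_of_ae_bound (by positivity) ?_
    filter_upwards [hae, MemLp.coeFn_toLp (memLp_of_continuous hρ
      (g := fun t => (u t : ℂ)) (by fun_prop) 2), coeFn_polynomialToLp hρ (p.map Complex.ofRealHom),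
      Lp.coeFn_sub x (polynomialToLp hρ (p.map Complex.ofRealHom))] with t ht h1 h2 h3
    have h4 : (p.map Complex.ofRealHom).eval ((t : ℝ) : ℂ) = ((p.eval t : ℝ) : ℂ) := by
      rw [eval_map]
      exact eval₂_at_apply Complex.ofRealHom t
    rw [h3, Pi.sub_apply, h2, hx, h1, h4, ← Complex.ofReal_sub, Complex.norm_real,
      Real.norm_eq_abs, abs_sub_comm]
    exact (hp t ht).le
  rw [dist_eq_norm]
  refine hle.trans_lt ?_
  rw [← mul_div_assoc, div_lt_iff₀ (by positivity)]
  nlinarith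

/-- The polynomials are dense in `L²(ρ)`. -/
theorem topologicalClosure_range_polynomialToLp [IsFiniteMeasure ρ] (hρ : ρ (Set.Icc 0 1)ᶜ = 0) :
    (LinearMap.range (polynomialToLp hρ)).topologicalClosure = ⊤ := by
  set K := (LinearMap.range (polynomialToLp hρ)).topologicalClosure with hK
  have hKc : IsClosed (K : Set (Lp ℂ 2 ρ)) := Submodule.isClosed_topologicalClosure _
  rw [eq_top_iff]
  have hd := BoundedContinuousFunction.toLp_denseRange (E := ℂ) (μ := ρ) ℂ (p := 2) (by norm_num)
  intro x _
  refine hKc.closure_subset_iff.2 ?_ (hd x)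
  rintro _ ⟨F, rfl⟩
  -- Weierstrass approximation is applied to real functions, hence the split into real and imaginary
  -- parts.
  have h1 := toLp_ofReal_mem_closure_range hρ (u := fun t => (F t).re) (by fun_prop)
  have h2 := toLp_ofReal_mem_closure_range hρ (u := fun t => (F t).im) (by fun_prop)
  have h3 := K.add_mem h1 (K.smul_mem Complex.I h2)
  refine (congrArg (· ∈ K) ?_).mpr h3
  apply Lp.ext
  rw [← MemLp.toLp_const_smul, ← MemLp.toLp_add]
  refine (BoundedContinuousFunction.coeFn_toLp 2 ρ ℂ F).trans
    (Filter.EventuallyEq.trans ?_ (MemLp.coeFn_toLp _).symm)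
  refine ae_of_all _ fun t => ?_
  simp only [Pi.add_apply, Pi.smul_apply, smul_eq_mul]
  rw [mul_comm, Complex.re_add_im]

/-- A probability measure with infinite support in `[0, 1]` is a spectral measure of a Jacobi
operator. -/
theorem exists_isJacobiSpectralMeasure [IsProbabilityMeasure ρ] (hρ : ρ (Set.Icc 0 1)ᶜ = 0)
    (hF : ∀ F : Set ℝ, F.Finite → ρ Fᶜ ≠ 0) :
    ∃ a b : ℕ → ℝ, (∀ n, 0 < a n) ∧ IsJacobiSpectralMeasure a b ρ := by
  have ht : MemLp (fun t : ℝ => ((t : ℝ) : ℂ)) ∞ ρ := memLp_of_continuous hρ (by fun_prop) ∞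
  set M := mulOperator ρ fun t => t with hM
  have hMs : IsSelfAdjoint M := isSelfAdjoint_mulOperator ht
  set f : ℕ → Lp ℂ 2 ρ := fun n => polynomialToLp hρ (monomial n 1) with hf
  have hMf : ∀ n, M (f n) = f (n + 1) := by
    intro n
    apply Lp.ext
    filter_upwards [coeFn_mulOperator ht (f n), coeFn_polynomialToLp hρ (monomial n 1),
      coeFn_polynomialToLp hρ (monomial (n + 1) 1)] with t h1 h2 h3
    rw [h1, h2, h3, eval_monomial, eval_monomial]
    ring
  have hli : LinearIndependent ℂ f := by
    have h1 := (basisMonomials ℂ).linearIndependent.map' (polynomialToLp hρ)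
      (LinearMap.ker_eq_bot.2 (polynomialToLp_injective hρ hF))
    rwa [coe_basisMonomials] at h1
  have hspan : (Submodule.span ℂ (Set.range f)).topologicalClosure = ⊤ := by
    rw [← topologicalClosure_range_polynomialToLp hρ, LinearMap.range_eq_map,
      ← (basisMonomials ℂ).span_eq, Submodule.map_span, ← Set.range_comp, coe_basisMonomials]
    rfl
  have hf0 : f 0 =ᵐ[ρ] fun _ => (1 : ℂ) := by
    filter_upwards [coeFn_polynomialToLp hρ (monomial 0 1)] with t h
    rw [h, eval_monomial, pow_zero, mul_one]
  -- The scalar measure of `x` has density `‖x‖²`, so the constant function `1` recovers `ρ`.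
  have hμ0 : (mulProjValuedMeasure ρ).scalarMeasure (f 0) = ρ := by
    rw [scalarMeasure_mulProjValuedMeasure]
    have h1 : (fun t => ENNReal.ofReal (‖f 0 t‖ ^ 2)) =ᵐ[ρ] 1 := by
      filter_upwards [hf0] with t h
      rw [h, norm_one, one_pow, ENNReal.ofReal_one, Pi.one_apply]
    rw [withDensity_congr_ae h1, withDensity_one]
  have hnorm : ‖f 0‖ = 1 := by
    have h1 := (mulProjValuedMeasure ρ).scalarMeasure_univ (f 0)
    rw [hμ0, measure_univ, eq_comm, ENNReal.ofReal_eq_one] at h1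
    exact (pow_eq_one_iff_of_nonneg (norm_nonneg _) two_ne_zero).1 h1
  obtain ⟨a, b, U, ha, hU, hJ⟩ := exists_jacobi_of_cyclic hMs hMf hli hspan hnorm
  refine ⟨a, b, ha, ((U.conjStarAlgEquiv M : EllTwo →L[ℂ] EllTwo) : EllTwo →ₗ[ℂ] EllTwo).toPMap ⊤,
    jacobiOperator_le_toPMap_top fun θ n => hJ θ n,
    (hMs.map U.conjStarAlgEquiv).toPMap_top, (mulProjValuedMeasure ρ).map U,
    ProjValuedMeasure.isSpectralMeasureOf_toPMap_top (fun x => ?_) (fun x => ?_), ?_⟩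
  · rw [ProjValuedMeasure.scalarMeasure_map]
    exact lintegral_sq_scalarMeasure_lt_top hρ _
  · rw [ProjValuedMeasure.scalarMeasure_map, integral_scalarMeasure_mulProjValuedMeasure,
      ← inner_mulOperator_self ht, ← hM, ← U.inner_map_map, U.apply_symm_apply]
    rfl
  · rw [ProjValuedMeasure.scalarMeasure_map, hU, hμ0]

end UnitInterval

end

theorem mainTheorem7 (s : ℕ → ℝ) :
    ((∃ a b : ℕ → ℝ, (∀ n, 0 < a n) ∧
        ∃ ρ : Measure ℝ, IsJacobiSpectralMeasure a b ρ ∧ ρ (Set.Icc 0 1)ᶜ = 0 ∧ HasMoments ρ s) ↔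
      s 0 = 1 ∧ HausdorffCondition s) ∧
    (HausdorffCondition s → HausdorffDeterminate s) ∧
    ((∃ ρ : Measure ℝ, SolvesHausdorff ρ s) → HausdorffDeterminate s) := by
  refine ⟨⟨?_, ?_⟩, ?_, ?_⟩
  · rintro ⟨a, b, ha, ρ, hJ, hsupp, hmom⟩
    refine ⟨?_, (SolvesHausdorff.hausdorffCondition_iff ⟨hmom, hsupp⟩).2 fun F hF =>
      hJ.measure_compl_ne_zero ha hF⟩
    rw [← (hmom 0).2]
    simp [measureReal_def, hJ.measure_univ]
  · rintro ⟨h0, hs⟩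
    obtain ⟨ρ, hρ⟩ := hs.exists_solvesHausdorff
    have := hρ.1.isFiniteMeasure
    have : IsProbabilityMeasure ρ := by
      refine ⟨?_⟩
      have h1 := (hρ.1 0).2
      simp only [pow_zero, integral_const, smul_eq_mul, mul_one, h0, measureReal_def] at h1
      exact (ENNReal.toReal_eq_one_iff _).1 h1
    obtain ⟨a, b, ha, hJ⟩ :=
      exists_isJacobiSpectralMeasure hρ.2 (hρ.hausdorffCondition_iff.1 hs)
    exact ⟨a, b, ha, ρ, hJ, hρ.2, hρ.1⟩
  · intro hs
    obtain ⟨ρ, hρ⟩ := hs.exists_solvesHausdorff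
    exact hρ.hausdorffDeterminate
  · rintro ⟨ρ, hρ⟩
    exact hρ.hausdorffDeterminate
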